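/- **Conventions.** A forest algebra $(H,V)$ consists of a commutative idempotent monoid $(H,+,0)$ of *forest types*, a monoid $(V,\cdot,1)$ of *context types*, and a faithful action of $V$ on $H$, such that for each $h\in H$ there is $I_h\in V$ with $I_h h'=h+h'$ for all $h'\in H$, and for each $h \in H$ there is $v\in V$ with $h=v\cdot 0$. A morphism of forest algebras is a pair of monoid morphisms that respects the action and $h\mapsto I_h$. For a set $\Sigma$, the free forest algebra $\Sigma^\Delta=(H_\Sigma,V_\Sigma)$ consists of the finite $\Sigma$-labelled forests, considered without regard to order and multiplicity of siblings, and of the contexts, i.e. forests in which exactly one leaf is a hole $X$. For $f\in H_\Sigma$, $\pi(f)\subseteq\Sigma^*$ is the set of label sequences of the (not necessarily maximal) paths of $f$ starting at a root. A forest algebra $(H,V)$ is *2-distributive* if for every finite alphabet $\Sigma$, every morphism $\phi:\Sigma^\Delta\to(H,V)$, every $c\in V_\Sigma$ and all $f_1,f_2\in H_\Sigma$ with $\pi(f_1)=\pi(f_2)$ one has $\phi(c(f_1+f_2))=\phi(cf_1+cf_2)$. For a finite forest algebra $(H,V)$ and $h\in H$, let $L_h\subseteq H_V$ be the preimage of $h$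 under the morphism $V^\Delta\to(H,V)$ that maps the context $v[X]$ to $v$ for each $v\in V$. The distributive normal form $\Psi:H_\Sigma\to H_\Sigma$ is defined recursively: if $f=\beta_1[f_1]+\dots+\beta_n[f_n]$, then $\Psi(f)=\sum_{\beta\in\{\beta_1,\dots,\beta_n\}}\beta\big[\Psi\big(\sum_{i:\beta_i=\beta}f_i\big)\big]$. A language $L\subseteq H_\Sigma$ is *regular* if it is recognized by a finite forest algebra, that is, $L=\phi^{-1}(\phi(L))$ for a morphism $\phi$ from $\Sigma^\Delta$ to a finite forest algebra. **Theorem.** 1. It is decidable whether a finite forest algebra is 2-distributive: there is an algorithm that, given finite tables of numbers, accepts exactly those that are the tables of the three operations $H\times H\to H$, $V\times V\to V$, $V\times H\to H$ of a 2-distributive finite forest algebra $(H,V)$, with respect to some enumerations of $H$ and $V$. 2. A finite forest algebra $(H,V)$ is 2-distributive if and only if $v(h+h')=vh+vh'$ for all $v\in V$ and all $h,h'\in H$ with $\pi(L_h)\cap\pi(L_{h'})\neq\emptyset$. 3. There is an algorithm that decides, given the operation tables of a finite forest algebra $(H,V)$ and $h,h'\in H$, whether $\pi(L_h)\cap\pi(L_{h'})\ne\emptyset$.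 4. For every finite alphabet $\Sigma$ and all $L_1,L_2\subseteq H_\Sigma$: $\pi(L_1)\cap\pi(L_2)\neq\emptyset$ if and only if $\Psi(L_1)\cap\Psi(L_2)\neq\emptyset$. 5. For every finite alphabet $\Sigma$ and every regular $L\subseteq H_\Sigma$, the language $\Psi(L)$ is regular as a language of unordered forests with multiplicities, where each normal form is taken without repeated siblings: it is accepted by a forest automaton whose states form a finite commutative (not necessarily idempotent) monoid. -/

import Mathlib

universe u v w z

/-! ### Forest algebras -/

/-- A horizontally commutative and idempotent forest algebra `(H, V)`. The horizontal monoid `H` is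
written additively, the vertical monoid `V` multiplicatively, and the action of `V` on `H` is `•`.
The map `ins` is the insertion `h ↦ I_h`, with `I_h h' = h + h'`. -/
class ForestAlgebra (H : Type u) (V : Type v) [AddCommMonoid H] [Monoid V] extends
    MulAction V H where
  add_idem : ∀ h : H, h + h = h
  faithful : ∀ v w : V, (∀ h : H, v • h = w • h) → v = w
  ins : H → V
  ins_smul : ∀ h h' : H, ins h • h' = h + h'
  exists_smul_zero : ∀ h : H, ∃ v : V, v • (0 : H) = h

/-- Morphisms of forest algebras. -/
structure ForestAlgebraHom (H : Type u) (V : Type v) (H' : Type w) (V' : Type z)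
    [AddCommMonoid H] [Monoid V] [ForestAlgebra H V]
    [AddCommMonoid H'] [Monoid V'] [ForestAlgebra H' V'] where
  onForests : H →+ H'
  onContexts : V →* V'
  map_smul : ∀ (v : V) (h : H), onForests (v • h) = onContexts v • onForests h
  map_ins : ∀ h : H, onContexts (ForestAlgebra.ins h) = ForestAlgebra.ins (onForests h)

/-! ### Forests -/

/-- Expressions for finite forests over the alphabet `α`: the empty forest, the union of two
forests, and the forest `a[f]` consisting of one tree with root label `a`. -/
inductive ForestTerm (α : Type u) : Type u
  | empty : ForestTerm α
  | add : ForestTerm α → ForestTerm α → ForestTerm α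
  | node : α → ForestTerm α → ForestTerm α

/-- Two expressions denote the same forest, where order and multiplicity of siblings are
disregarded. -/
inductive ForestTerm.Same {α : Type u} : ForestTerm α → ForestTerm α → Prop
  | refl (s : ForestTerm α) : Same s s
  | symm {s t : ForestTerm α} : Same s t → Same t s
  | trans {r s t : ForestTerm α} : Same r s → Same s t → Same r t
  | add_congr {s s' t t' : ForestTerm α} : Same s s' → Same t t' → Same (s.add t) (s'.add t')
  | node_congr (a : α) {s s' : ForestTerm α} : Same s s' → Same (.node a s) (.node a s')
  | assoc (r s t : ForestTerm α) : Same ((r.add s).add t) (r.add (s.add t))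
  | comm (s t : ForestTerm α) : Same (s.add t) (t.add s)
  | empty_add (s : ForestTerm α) : Same (ForestTerm.empty.add s) s
  | idem (s : ForestTerm α) : Same (s.add s) s

instance ForestTerm.setoid (α : Type u) : Setoid (ForestTerm α) where
  r := ForestTerm.Same
  iseqv := ⟨.refl, .symm, .trans⟩

/-- The set `H_α` of finite forests over `α`, without regard to order and multiplicity of siblings.
A forest is the same thing as a finite set of trees, see `Forest.ext_roots`. -/
def Forest (α : Type u) : Type u := Quotient (ForestTerm.setoid α)

namespace Forest

variable {α : Type u}

/-- The forest denoted by an expression. -/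
def mk (t : ForestTerm α) : Forest α := Quotient.mk _ t

/-- The forest `a[f]` consisting of a single tree. -/
def node (a : α) : Forest α → Forest α :=
  Quotient.map (ForestTerm.node a) (fun _ _ h => ForestTerm.Same.node_congr a h)

instance : Zero (Forest α) := ⟨mk .empty⟩

instance : Add (Forest α) :=
  ⟨Quotient.map₂ ForestTerm.add (fun _ _ h _ _ h' => ForestTerm.Same.add_congr h h')⟩

theorem add_idem (f : Forest α) : f + f = f :=
  Quotient.inductionOn f fun s => Quotient.sound (.idem s)

protected theorem zero_add (f : Forest α) : 0 + f = f :=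
  Quotient.inductionOn f fun s => Quotient.sound (.empty_add s)

protected theorem add_comm (f g : Forest α) : f + g = g + f :=
  Quotient.inductionOn₂ f g fun s t => Quotient.sound (.comm s t)

instance : AddCommMonoid (Forest α) where
  add_assoc f g h := Quotient.inductionOn₃ f g h fun r s t => Quotient.sound (.assoc r s t)
  zero_add := Forest.zero_add
  add_zero f := (Forest.add_comm f 0).trans (Forest.zero_add f)
  add_comm := Forest.add_comm
  nsmul := nsmulRec

theorem induction {p : Forest α → Prop} (zero : p 0) (add : ∀ f g, p f → p g → p (f + g))
    (node : ∀ a f, p f → p (node a f)) (f : Forest α) : p f := by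
  refine Quotient.inductionOn f fun t => ?_
  induction t with
  | empty => exact zero
  | add s t hs ht => exact add _ _ hs ht
  | node a t ht => exact node a _ ht

/-- Auxiliary recursion on expressions. -/
def foldTerm {M : Type v} [AddCommMonoid M] (n : α → Forest α → M → M) : ForestTerm α → M
  | .empty => 0
  | .add s t => foldTerm n s + foldTerm n t
  | .node a t => n a (mk t) (foldTerm n t)

/-- Recursion on forests with values in a commutative idempotent monoid; `n a f x` is the value at
the tree `a[f]`, where `x` is the value at `f`. -/
def fold {M : Type v} [AddCommMonoid M] (idem : ∀ x : M, x + x = x) (n : α → Forest α → M → M) :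
    Forest α → M :=
  Quotient.lift (foldTerm n)
    (by
      intro s t h
      induction h with
      | refl => rfl
      | symm _ ih => exact ih.symm
      | trans _ _ ih ih' => exact ih.trans ih'
      | add_congr _ _ ih ih' => exact congrArg₂ (· + ·) ih ih'
      | node_congr a h ih => exact congrArg₂ (n a) (Quotient.sound h) ih
      | assoc => exact add_assoc _ _ _
      | comm => exact add_comm _ _
      | empty_add => exact zero_add _
      | idem => exact idem _)

section fold

variable {M : Type v} [AddCommMonoid M] (idem : ∀ x : M, x + x = x) (n : α → Forest α → M → M)

theorem fold_zero : fold idem n 0 = 0 := rfl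

theorem fold_add (f g : Forest α) : fold idem n (f + g) = fold idem n f + fold idem n g :=
  Quotient.inductionOn₂ f g fun _ _ => rfl

theorem fold_node (a : α) (f : Forest α) : fold idem n (node a f) = n a f (fold idem n f) :=
  Quotient.inductionOn f fun _ => rfl

end fold

/-- `Set β` as a commutative idempotent monoid under union, used for definitions by recursion. -/
abbrev setUnionMonoid (β : Type v) : AddCommMonoid (Set β) where
  add := (· ∪ ·)
  zero := ∅
  add_assoc := Set.union_assoc
  zero_add := Set.empty_union
  add_zero := Set.union_empty
  add_comm := Set.union_comm
  nsmul := @nsmulRec _ ⟨∅⟩ ⟨(· ∪ ·)⟩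

/-- `ℕ` as a commutative idempotent monoid under maximum, used for definitions by recursion. -/
abbrev natMaxMonoid : AddCommMonoid ℕ where
  add := max
  zero := 0
  add_assoc := max_assoc
  zero_add := Nat.zero_max
  add_zero := Nat.max_zero
  add_comm := max_comm
  nsmul := @nsmulRec _ ⟨0⟩ ⟨max⟩

/-- The set of trees of a forest; the pair `(a, g)` stands for the tree `a[g]`. -/
def roots : Forest α → Set (α × Forest α) :=
  @fold α _ (setUnionMonoid _) Set.union_self fun a f _ => {(a, f)}

theorem roots_zero : roots (0 : Forest α) = ∅ := rfl

theorem roots_add (f g : Forest α) : roots (f + g) = roots f ∪ roots g :=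
  @fold_add α _ (setUnionMonoid _) _ _ f g

theorem roots_node (a : α) (f : Forest α) : roots (node a f) = {(a, f)} :=
  @fold_node α _ (setUnionMonoid _) _ _ a f

/-- The set of root labels of a forest. -/
def labels (f : Forest α) : Set α := Prod.fst '' roots f

/-- The height of a forest. -/
def depth : Forest α → ℕ := @fold α _ natMaxMonoid max_self fun _ _ x => x + 1

theorem depth_zero : depth (0 : Forest α) = 0 := rfl

theorem depth_add (f g : Forest α) : depth (f + g) = max (depth f) (depth g) :=
  @fold_add α _ natMaxMonoid _ _ f g

theorem depth_node (a : α) (f : Forest α) : depth (node a f) = depth f + 1 :=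
  @fold_node α _ natMaxMonoid _ _ a f

/-- The set `π(f)` of label sequences of the paths of `f`, not necessarily maximal, that start at a
root (and the empty path). -/
def paths : Forest α → Set (List α) := fun f =>
  insert [] (@fold α _ (setUnionMonoid _) Set.union_self
    (fun a _ P => List.cons a '' insert [] P) f)

theorem paths_zero : paths (0 : Forest α) = {[]} := insert_empty_eq _

theorem paths_add (f g : Forest α) : paths (f + g) = paths f ∪ paths g := by
  unfold paths
  rw [@fold_add α _ (setUnionMonoid _)]
  exact Set.insert_union_distrib _ _ _

theorem paths_node (a : α) (f : Forest α) :
    paths (node a f) = insert [] (List.cons a '' paths f) := by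
  unfold paths
  rw [@fold_node α _ (setUnionMonoid _)]

open Classical in
/-- The sum of all `g` such that `b[g]` is a tree of the forest. -/
noncomputable def below (b : α) : Forest α → Forest α :=
  fold add_idem fun a f _ => if a = b then f else 0

theorem below_zero (b : α) : below b 0 = 0 := rfl

theorem below_add (b : α) (f g : Forest α) : below b (f + g) = below b f + below b g :=
  fold_add _ _ f g

open Classical in
theorem below_node (b a : α) (f : Forest α) : below b (node a f) = if a = b then f else 0 :=
  fold_node _ _ a f

theorem add_node_of_mem {a : α} {g : Forest α} (f : Forest α) (h : (a, g) ∈ roots f) :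
    f + node a g = f := by
  induction f using Forest.induction with
  | zero => exact h.elim
  | add f f' ih ih' =>
    rw [roots_add] at h
    rcases h with h | h
    · rw [add_right_comm, ih h]
    · rw [add_assoc, ih' h]
  | node b f _ =>
    rw [roots_node, Set.mem_singleton_iff, Prod.mk.injEq] at h
    rw [h.1, h.2, add_idem]

theorem add_of_roots_subset (f g : Forest α) (h : roots g ⊆ roots f) : f + g = f := by
  induction g using Forest.induction with
  | zero => exact add_zero f
  | add g g' ih ih' =>
    rw [roots_add] at h
    rw [← add_assoc, ih (Set.subset_union_left.trans h), ih' (Set.subset_union_right.trans h)]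
  | node b g _ => exact add_node_of_mem f (h (by rw [roots_node]; rfl))

/-- A forest is determined by its set of trees. -/
theorem ext_roots {f g : Forest α} (h : roots f = roots g) : f = g := by
  rw [← add_of_roots_subset f g h.ge, add_comm, add_of_roots_subset g f h.le]

theorem finite_roots (f : Forest α) : (roots f).Finite := by
  induction f using Forest.induction with
  | zero => exact Set.finite_empty
  | add f g hf hg => rw [roots_add]; exact hf.union hg
  | node a f _ => rw [roots_node]; exact Set.finite_singleton _

theorem finite_labels (f : Forest α) : (labels f).Finite := (finite_roots f).image _

theorem depth_lt_of_mem {a : α} {g : Forest α} (f : Forest α) (h : (a, g) ∈ roots f) :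
    depth g < depth f := by
  have := congrArg depth (add_node_of_mem f h)
  rw [depth_add, depth_node] at this
  omega

theorem depth_below_le (b : α) (f : Forest α) : depth (below b f) ≤ depth f - 1 := by
  induction f using Forest.induction with
  | zero => exact Nat.zero_le _
  | add f g hf hg => rw [below_add, depth_add, depth_add]; omega
  | node a f _ =>
    rw [below_node, depth_node]
    split_ifs
    · omega
    · rw [depth_zero]; omega

theorem depth_below_lt {b : α} {f : Forest α} (h : b ∈ labels f) :
    depth (below b f) < depth f := by
  obtain ⟨⟨a, g⟩, hg, rfl⟩ := h
  have h1 := depth_lt_of_mem f hg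
  have h2 := depth_below_le a f
  change depth (below a f) < depth f
  omega

/-- The distributive normal form `Ψ(f)`: trees with the same root label are merged, recursively. -/
noncomputable def normalForm (f : Forest α) : Forest α :=
  ∑ b ∈ (finite_labels f).toFinset.attach, node b.1 (normalForm (below b.1 f))
termination_by depth f
decreasing_by exact depth_below_lt ((finite_labels f).mem_toFinset.1 b.2)

/-- The defining equation of `normalForm`. -/
theorem normalForm_eq (f : Forest α) : normalForm f =
    ∑ b ∈ (finite_labels f).toFinset, node b (normalForm (below b f)) := by
  rw [normalForm, Finset.sum_attach (finite_labels f).toFinset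
    (fun b => node b (normalForm (below b f)))]

end Forest

/-! ### Contexts and the free forest algebra -/

/-- Contexts over `α`, that is, forests in which exactly one leaf is a hole `X`:
`hole f` is the context `X + f`, and `node f a c` is the context `f + a[c]`. -/
inductive Context (α : Type u) : Type u
  | hole : Forest α → Context α
  | node : Forest α → α → Context α → Context α

namespace Context

variable {α : Type u}

/-- Insertion of a forest into the hole of a context. -/
def apply : Context α → Forest α → Forest α
  | hole f, t => f + t
  | node f a c, t => f + Forest.node a (apply c t)

/-- The context `f + c`. -/
def addForest (f : Forest α) : Context α → Context α
  | hole g => hole (f + g)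
  | node g a c => node (f + g) a c

/-- Insertion of a context into the hole of a context. -/
def comp : Context α → Context α → Context α
  | hole f, d => addForest f d
  | node f a c, d => node f a (comp c d)

/-- The context `a[X]`. -/
def letter (a : α) : Context α := node 0 a (hole 0)

instance : One (Context α) := ⟨hole 0⟩

instance : Mul (Context α) := ⟨comp⟩

theorem addForest_zero (c : Context α) : addForest 0 c = c := by
  cases c <;> simp [addForest]

theorem addForest_add (f g : Forest α) (c : Context α) :
    addForest (f + g) c = addForest f (addForest g c) := by
  cases c <;> simp [addForest, add_assoc]

theorem comp_addForest (f : Forest α) (c d : Context α) :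
    comp (addForest f c) d = addForest f (comp c d) := by
  cases c with
  | hole g => exact addForest_add f g d
  | node g a c => rfl

theorem comp_assoc (c d e : Context α) : comp (comp c d) e = comp c (comp d e) := by
  induction c with
  | hole f => exact comp_addForest f d e
  | node f a c ih => exact congrArg (node f a) ih

theorem comp_one (c : Context α) : comp c (hole 0) = c := by
  induction c with
  | hole f => exact congrArg hole (add_zero f)
  | node f a c ih => exact congrArg (node f a) ih

instance : Monoid (Context α) where
  mul_assoc := comp_assoc
  one_mul := addForest_zero
  mul_one := comp_one

theorem apply_addForest (f : Forest α) (c : Context α) (t : Forest α) :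
    apply (addForest f c) t = f + apply c t := by
  cases c <;> simp [addForest, apply, add_assoc]

theorem apply_comp (c d : Context α) (t : Forest α) :
    apply (comp c d) t = apply c (apply d t) := by
  induction c with
  | hole f => exact apply_addForest f d t
  | node f a c ih => exact congrArg (fun x => f + Forest.node a x) ih

instance : MulAction (Context α) (Forest α) where
  smul := apply
  one_smul := zero_add
  mul_smul := apply_comp

/-- A bound for the heights of the forests that occur in a context. -/
def bound : Context α → ℕ
  | hole f => f.depth
  | node f _ c => max f.depth (bound c)

theorem depth_le_apply (c : Context α) (t : Forest α) : t.depth ≤ (apply c t).depth := by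
  induction c with
  | hole f => rw [apply, Forest.depth_add]; exact le_max_right _ _
  | node f a c ih => rw [apply, Forest.depth_add, Forest.depth_node]; omega

theorem insert_cancel {β : Type u} {s t : Set β} {x y : β} (hxs : x ∉ s) (hxt : x ∉ t) (hys : y ∉ s)
    (hyt : y ∉ t) (h : s ∪ {x} = t ∪ {y}) : s = t ∧ x = y := by
  have hxy : x = y := by
    have hx : x ∈ t ∪ {y} := h ▸ Or.inr rfl
    rcases hx with hx | hx
    · exact (hxt hx).elim
    · exact hx
  subst hxy
  refine ⟨Set.ext fun z => ⟨fun hz => ?_, fun hz => ?_⟩, rfl⟩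
  · have hz' : z ∈ t ∪ {x} := h ▸ Or.inl hz
    rcases hz' with hz' | hz'
    · exact hz'
    · exact (hxs (Set.mem_singleton_iff.1 hz' ▸ hz)).elim
  · have hz' : z ∈ s ∪ {x} := h ▸ Or.inl hz
    rcases hz' with hz' | hz'
    · exact hz'
    · exact (hxt (Set.mem_singleton_iff.1 hz' ▸ hz)).elim

theorem add_node_cancel {f g p q : Forest α} {a b : α} (hfp : f.depth ≤ p.depth)
    (hgp : g.depth ≤ p.depth) (hfq : f.depth ≤ q.depth) (hgq : g.depth ≤ q.depth)
    (h : f + Forest.node a p = g + Forest.node b q) : f = g ∧ a = b ∧ p = q := by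
  have h' := congrArg Forest.roots h
  rw [Forest.roots_add, Forest.roots_add, Forest.roots_node, Forest.roots_node] at h'
  have key := insert_cancel
    (fun hm => absurd (Forest.depth_lt_of_mem f hm) (by omega))
    (fun hm => absurd (Forest.depth_lt_of_mem g hm) (by omega))
    (fun hm => absurd (Forest.depth_lt_of_mem f hm) (by omega))
    (fun hm => absurd (Forest.depth_lt_of_mem g hm) (by omega)) h'
  exact ⟨Forest.ext_roots key.1, (Prod.mk.inj key.2).1, (Prod.mk.inj key.2).2⟩

theorem eq_of_apply_eq {b : α} {t : Forest α} : ∀ (c d : Context α), bound c ≤ t.depth →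
    bound d ≤ t.depth → apply c (Forest.node b t) = apply d (Forest.node b t) → c = d
  | hole f, hole g, hc, hd, h => by
    simp only [bound] at hc hd
    rw [(add_node_cancel hc hd hc hd h).1]
  | hole f, node g a d, hc, hd, h => by
    simp only [bound] at hc hd
    have h1 := depth_le_apply d (Forest.node b t)
    rw [Forest.depth_node] at h1
    have h2 := (add_node_cancel hc (by omega) (by omega) (by omega) h).2.2
    rw [← h2] at h1
    omega
  | node f a c, hole g, hc, hd, h => by
    simp only [bound] at hc hd
    have h1 := depth_le_apply c (Forest.node b t)
    rw [Forest.depth_node] at h1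
    have h2 := (add_node_cancel (by omega) (by omega) (by omega) hd h).2.2
    rw [h2] at h1
    omega
  | node f a c, node g a' d, hc, hd, h => by
    simp only [bound] at hc hd
    have h1 := depth_le_apply c (Forest.node b t)
    have h2 := depth_le_apply d (Forest.node b t)
    rw [Forest.depth_node] at h1 h2
    obtain ⟨h3, h4, h5⟩ := add_node_cancel (by omega) (by omega) (by omega) (by omega) h
    rw [h3, h4, eq_of_apply_eq c d (by omega) (by omega) h5]

theorem exists_depth (b : α) (n : ℕ) : ∃ t : Forest α, t.depth = n := by
  induction n with
  | zero => exact ⟨0, rfl⟩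
  | succ n ih =>
    obtain ⟨t, ht⟩ := ih
    exact ⟨Forest.node b t, by rw [Forest.depth_node, ht]⟩

theorem faithful (c d : Context α) (h : ∀ t : Forest α, c • t = d • t) : c = d := by
  rcases isEmpty_or_nonempty α with hα | ⟨⟨b⟩⟩
  · cases c with
    | node f a c => exact hα.elim a
    | hole f =>
      cases d with
      | node f a c => exact hα.elim a
      | hole g =>
        have h0 : f + 0 = g + 0 := h 0
        rw [add_zero, add_zero] at h0
        rw [h0]
  · obtain ⟨t, ht⟩ := exists_depth b (max (bound c) (bound d))
    exact eq_of_apply_eq c d (by omega) (by omega) (h (Forest.node b t))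

/-- The free forest algebra `α^Δ`. -/
instance : ForestAlgebra (Forest α) (Context α) where
  add_idem := Forest.add_idem
  faithful := faithful
  ins := hole
  ins_smul _ _ := rfl
  exists_smul_zero f := ⟨hole f, add_zero f⟩

end Context

/-! ### The morphism determined by the images of the letters -/

section eval

variable {α : Type u} {H : Type v} {V : Type w} [AddCommMonoid H] [Monoid V] [ForestAlgebra H V]

/-- The forest part of the morphism `α^Δ → (H, V)` that maps `a[X]` to `g a`. -/
def Forest.eval (g : α → V) : Forest α → H :=
  Forest.fold (ForestAlgebra.add_idem V) fun a _ x => g a • x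

/-- The context part of the morphism `α^Δ → (H, V)` that maps `a[X]` to `g a`. -/
def Context.eval (g : α → V) : Context α → V
  | .hole f => ForestAlgebra.ins (Forest.eval g f : H)
  | .node f a c => ForestAlgebra.ins (Forest.eval g f : H) * (g a * Context.eval g c)

theorem ForestAlgebra.ins_add (h h' : H) :
    (ForestAlgebra.ins (h + h') : V) = ForestAlgebra.ins h * ForestAlgebra.ins h' :=
  ForestAlgebra.faithful _ _ fun x : H => by
    rw [mul_smul, ForestAlgebra.ins_smul, ForestAlgebra.ins_smul, ForestAlgebra.ins_smul, add_assoc]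

theorem ForestAlgebra.ins_zero : (ForestAlgebra.ins (0 : H) : V) = 1 :=
  ForestAlgebra.faithful _ _ fun x : H => by
    rw [ForestAlgebra.ins_smul, one_smul, zero_add]

theorem Forest.eval_add (g : α → V) (f f' : Forest α) :
    (Forest.eval g (f + f') : H) = Forest.eval g f + Forest.eval g f' :=
  Forest.fold_add _ _ f f'

theorem Forest.eval_node (g : α → V) (a : α) (f : Forest α) :
    (Forest.eval g (Forest.node a f) : H) = g a • (Forest.eval g f : H) :=
  Forest.fold_node _ _ a f

theorem Context.eval_addForest (g : α → V) (f : Forest α) (c : Context α) :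
    Context.eval (H := H) g (Context.addForest f c) =
      ForestAlgebra.ins (Forest.eval g f : H) * Context.eval (H := H) g c := by
  cases c <;>
    simp only [Context.addForest, Context.eval, Forest.eval_add, ForestAlgebra.ins_add, mul_assoc]

theorem Context.eval_comp (g : α → V) (c d : Context α) :
    Context.eval (H := H) g (Context.comp c d) =
      Context.eval (H := H) g c * Context.eval (H := H) g d := by
  induction c with
  | hole f => exact Context.eval_addForest g f d
  | node f a c ih => simp only [Context.comp, Context.eval, ih, mul_assoc]

theorem Context.eval_apply (g : α → V) (c : Context α) (t : Forest α) :
    (Forest.eval g (Context.apply c t) : H) =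
      Context.eval (H := H) g c • (Forest.eval g t : H) := by
  induction c with
  | hole f => rw [Context.apply, Forest.eval_add, Context.eval, ForestAlgebra.ins_smul]
  | node f a c ih =>
    rw [Context.apply, Forest.eval_add, Forest.eval_node, ih, Context.eval, mul_smul,
      ForestAlgebra.ins_smul, mul_smul]

/-- The morphism `α^Δ → (H, V)` that maps the context `a[X]` to `g a`, for each letter `a`. -/
def ForestAlgebraHom.ofLetters (H : Type v) {V : Type w} [AddCommMonoid H] [Monoid V]
    [ForestAlgebra H V] (g : α → V) :
    ForestAlgebraHom (Forest α) (Context α) H V where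
  onForests := ⟨⟨Forest.eval g, rfl⟩, Forest.eval_add g⟩
  onContexts := ⟨⟨Context.eval (H := H) g, ForestAlgebra.ins_zero⟩, Context.eval_comp g⟩
  map_smul := Context.eval_apply g
  map_ins _ := rfl

theorem ForestAlgebraHom.ofLetters_letter (g : α → V) (a : α) :
    (ForestAlgebraHom.ofLetters H g).onContexts (Context.letter a) = g a := by
  change (ForestAlgebra.ins (0 : H) : V) * (g a * ForestAlgebra.ins (0 : H)) = g a
  rw [ForestAlgebra.ins_zero, one_mul, mul_one]

end eval

/-! ### 2-distributivity and common pathsets -/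

/-- `(H, V)` is 2-distributive: for every finite alphabet `A`, every morphism `φ : A^Δ → (H, V)`,
every context `c` and all forests `f₁`, `f₂` with `π(f₁) = π(f₂)`,
one has `φ(c(f₁ + f₂)) = φ(c f₁ + c f₂)`. -/
def IsTwoDistributive (H : Type u) (V : Type v) [AddCommMonoid H] [Monoid V]
    [ForestAlgebra H V] : Prop :=
  ∀ (A : Type) [Finite A] (φ : ForestAlgebraHom (Forest A) (Context A) H V)
    (c : Context A) (f₁ f₂ : Forest A), f₁.paths = f₂.paths →
    φ.onForests (c • (f₁ + f₂)) = φ.onForests (c • f₁ + c • f₂)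

/-- The preimage of the forest type `h` under the morphism `V^Δ → (H, V)` that maps the context
`v[X]` to `v`, for each `v ∈ V`. -/
def typeLanguage {H : Type u} (V : Type v) [AddCommMonoid H] [Monoid V] [ForestAlgebra H V]
    (h : H) : Set (Forest V) :=
  (ForestAlgebraHom.ofLetters H (id : V → V)).onForests ⁻¹' {h}

/-- The pathsets `π(L₁)` and `π(L₂)` have an element in common. -/
def HaveCommonPathset {α : Type u} (L₁ L₂ : Set (Forest α)) : Prop :=
  (Forest.paths '' L₁ ∩ Forest.paths '' L₂).Nonempty

/-! ### Regular languages -/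

/-- A forest language is regular if it is recognized by a finite (horizontally commutative and
idempotent) forest algebra. -/
def IsRegularForestLanguage {α : Type u} (L : Set (Forest α)) : Prop :=
  ∃ (H V : Type) (_ : AddCommMonoid H) (_ : Monoid V) (_ : ForestAlgebra H V)
    (φ : ForestAlgebraHom (Forest α) (Context α) H V),
    Finite H ∧ Finite V ∧ L = φ.onForests ⁻¹' (φ.onForests '' L)

namespace ForestTerm

variable {α : Type u}

/-- The value of an expression in a commutative monoid `M` on which every letter acts by a map. -/
def run {M : Type v} [AddCommMonoid M] (δ : α → M → M) : ForestTerm α → M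
  | empty => 0
  | add s t => run δ s + run δ t
  | node a t => δ a (run δ t)

/-- A language of finite forests without regard to the order of siblings, but with multiplicities,
is regular if it is accepted by a forest automaton whose states form a finite commutative monoid,
which need not be idempotent. A language of such forests is given as a set of expressions
(automatically closed under the laws of commutative monoids, if it is regular). -/
def IsRegular (K : Set (ForestTerm α)) : Prop :=
  ∃ (M : Type) (_ : AddCommMonoid M) (δ : α → M → M) (F : Set M),
    Finite M ∧ ∀ t : ForestTerm α, t ∈ K ↔ run δ t ∈ F

/-- The set of root labels. -/
def rootLabels : ForestTerm α → Set α
  | empty => ∅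
  | add s t => rootLabels s ∪ rootLabels t
  | node a _ => {a}

/-- No two distinct sibling nodes carry the same label; here nodes are counted with
multiplicity. -/
def Reduced : ForestTerm α → Prop
  | empty => True
  | add s t => Reduced s ∧ Reduced t ∧ Disjoint (rootLabels s) (rootLabels t)
  | node _ t => Reduced t

end ForestTerm

/-- The language `Ψ(L)` of distributive normal forms as a language of forests with multiplicities,
in which every normal form is taken without repeated siblings. -/
def normalFormTerms {α : Type u} (L : Set (Forest α)) : Set (ForestTerm α) :=
  {t | t.Reduced ∧ Forest.mk t ∈ Forest.normalForm '' L}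

/-! ### Finite forest algebras as inputs of algorithms -/

/-- The tables of the operations `+ : H × H → H`, `· : V × V → V` and `· : V × H → H`, as lists of
rows. -/
abbrev OperationTables : Type :=
  List (List ℕ) × List (List ℕ) × List (List ℕ)

/-- The operation tables of a finite forest algebra with respect to enumerations of `H` and `V`. -/
def operationTables {H : Type u} {V : Type v} [AddCommMonoid H] [Monoid V] [ForestAlgebra H V]
    {n m : ℕ} (eH : H ≃ Fin n) (eV : V ≃ Fin m) : OperationTables :=
  (List.ofFn fun i => List.ofFn fun j => (eH (eH.symm i + eH.symm j) : ℕ),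
   List.ofFn fun i => List.ofFn fun j => (eV (eV.symm i * eV.symm j) : ℕ),
   List.ofFn fun i => List.ofFn fun j => (eH (eV.symm i • eH.symm j) : ℕ))

/-!
The normal form of a forest `f` is the prefix tree of its pathset `π(f)`, so two forests have equal
normal forms if and only if they have equal pathsets (`Forest.normalForm_eq_iff`). Relabelling
letters by their images in `V` reduces 2-distributivity over arbitrary alphabets to the alphabet `V`
and, there, to pairs of forest types with a common pathset (`isTwoDistributive_iff`).

What remains is to control which values are taken by the forests with a given pathset. For a
recursion over the pathset it is not enough to know these values, as the trees with root label `a`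
in one forest may share out the pathset below `a` among themselves. The right notion is that of a
set `E ⊆ H` realized by a pathset `π(p)`: there is a family of forests whose pathsets have the union
`π(p)` and whose set of values is `E` (`Realizes`). If `p` and `q` have no common root label, the
sets realized by `p + q` are determined by those realized by `p` and by `q` (`Realizes.add_iff`);
the sets realized by `a[p]` are determined by those realized by `p` (`Realizes.node_iff`); and `{h}`
is realized by `π(p)` if and only if some forest with this pathset has value `h`, because `H` is
idempotent (`Realizes.singleton_iff`).

As there are only finitely many sets of subsets of `H`, sending a reduced expression to its root
labels and the sets it realizes gives a finite congruence that saturates the language of normal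
forms (`ForestTerm.isRegular_normalFormTerms`).

For the algorithms, the triples `(j, E, E')` such that `E` and `E'` are both realized by one pathset
whose root labels are among the first `j` contexts form the least set closed under a step
that adds a tree with the next root label. That `({h}, {h'})` lies in every closed set of triples is
expressed by a formula in which subsets of `H` and sets of triples are numbers, read as bit
patterns, and all quantifiers are bounded (`commonPathset_iff`); such formulas are primitive
recursive. So are the axioms of a forest algebra, as conditions on operation tables
(`OperationTables.IsValid`).
-/

/-! ### Paths, subforests and relabelling -/

namespace Forest

variable {α : Type u} {β : Type v}

theorem nil_mem_paths (f : Forest α) : [] ∈ paths f := Set.mem_insert _ _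

theorem cons_mem_paths {a : α} {l : List α} {f : Forest α} :
    a :: l ∈ paths f ↔ ∃ g, (a, g) ∈ roots f ∧ l ∈ paths g := by
  induction f using Forest.induction with
  | zero => simp [paths_zero, roots_zero]
  | add f g hf hg => simp [paths_add, roots_add, hf, hg, or_and_right, exists_or]
  | node b f _ =>
    rw [paths_node, roots_node]
    simp only [Set.mem_insert_iff, Set.mem_image, List.cons.injEq, Set.mem_singleton_iff,
      Prod.mk.injEq, reduceCtorEq, false_or]
    constructor
    · rintro ⟨l', h, rfl, rfl⟩
      exact ⟨f, ⟨rfl, rfl⟩, h⟩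
    · rintro ⟨_, ⟨rfl, rfl⟩, h⟩
      exact ⟨l, h, rfl, rfl⟩

theorem mem_labels {a : α} {f : Forest α} : a ∈ labels f ↔ ∃ g, (a, g) ∈ roots f := by
  simp [labels]

theorem mem_labels_iff_mem_paths {a : α} {f : Forest α} : a ∈ labels f ↔ [a] ∈ paths f := by
  simp [mem_labels, cons_mem_paths, nil_mem_paths]

theorem labels_add (f g : Forest α) : labels (f + g) = labels f ∪ labels g := by
  rw [labels, roots_add, Set.image_union]; rfl

theorem labels_node (a : α) (f : Forest α) : labels (node a f) = {a} := by
  rw [labels, roots_node, Set.image_singleton]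

theorem labels_zero : labels (0 : Forest α) = ∅ := Set.image_empty _

theorem eq_zero_of_labels {f : Forest α} (h : labels f = ∅) : f = 0 :=
  ext_roots (by rw [roots_zero]; exact Set.image_eq_empty.1 h)

theorem mem_roots_below {b c : α} {f g : Forest α} :
    (c, g) ∈ roots (below b f) ↔ ∃ k, (b, k) ∈ roots f ∧ (c, g) ∈ roots k := by
  induction f using Forest.induction with
  | zero => simp [below_zero, roots_zero]
  | add f f' hf hf' => simp [below_add, roots_add, hf, hf', or_and_right, exists_or]
  | node a f _ =>
    rw [below_node, roots_node]
    by_cases h : a = b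
    · subst h; simp
    · simp [h, roots_zero, Ne.symm h]

theorem cons_mem_paths_iff_below {a : α} {l : List α} {f : Forest α} :
    a :: l ∈ paths f ↔ a ∈ labels f ∧ l ∈ paths (below a f) := by
  rw [cons_mem_paths, mem_labels]
  cases l with
  | nil => simp [nil_mem_paths]
  | cons b l =>
    simp only [cons_mem_paths, mem_roots_below]
    constructor
    · rintro ⟨g, h1, k, h2, h3⟩
      exact ⟨⟨g, h1⟩, k, ⟨g, h1, h2⟩, h3⟩
    · rintro ⟨_, k, ⟨g, h1, h2⟩, h3⟩
      exact ⟨g, h1, k, h2, h3⟩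

theorem labels_eq_of_paths_eq {f g : Forest α} (h : paths f = paths g) : labels f = labels g := by
  ext a
  rw [mem_labels_iff_mem_paths, mem_labels_iff_mem_paths, h]

theorem paths_below_eq {f g : Forest α} (h : paths f = paths g) {b : α} (hb : b ∈ labels f) :
    paths (below b f) = paths (below b g) := by
  ext l
  have hb' := labels_eq_of_paths_eq h ▸ hb
  have := cons_mem_paths_iff_below (a := b) (l := l) (f := f)
  rw [h, cons_mem_paths_iff_below] at this
  simpa [hb, hb'] using this.symm

open Classical in
/-- The trees of a forest whose root labels lie in `S`. -/
noncomputable def keep (S : Set α) : Forest α → Forest α :=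
  fold add_idem fun a f _ => if a ∈ S then node a f else 0

theorem mem_roots_keep {S : Set α} {f : Forest α} {x : α × Forest α} :
    x ∈ roots (keep S f) ↔ x ∈ roots f ∧ x.1 ∈ S := by
  induction f using Forest.induction with
  | zero => rw [keep, fold_zero]; simp [roots_zero]
  | add f g hf hg =>
    rw [keep, fold_add, roots_add, Set.mem_union, ← keep, hf, hg, roots_add, Set.mem_union,
      or_and_right]
  | node a f _ =>
    rw [keep, fold_node]
    split_ifs with h
    · simp only [roots_node, Set.mem_singleton_iff]
      exact ⟨fun e => ⟨e, by rw [e]; exact h⟩, And.left⟩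
    · simp only [roots_node, Set.mem_singleton_iff, roots_zero]
      exact ⟨False.elim, fun ⟨e, h'⟩ => h (by rw [e] at h'; exact h')⟩

theorem keep_add_keep_compl (S : Set α) (f : Forest α) : keep S f + keep Sᶜ f = f := by
  refine ext_roots (Set.ext fun x => ?_)
  rw [roots_add, Set.mem_union, mem_roots_keep, mem_roots_keep]
  by_cases h : x.1 ∈ S <;> simp [h]

theorem labels_keep (S : Set α) (f : Forest α) : labels (keep S f) = labels f ∩ S := by
  ext a
  simp [mem_labels, mem_roots_keep]

theorem cons_mem_paths_keep {S : Set α} {f : Forest α} {a : α} {l : List α} :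
    a :: l ∈ paths (keep S f) ↔ a :: l ∈ paths f ∧ a ∈ S := by
  simp only [cons_mem_paths, mem_roots_keep]
  constructor
  · rintro ⟨g, ⟨h1, h2⟩, h3⟩
    exact ⟨⟨g, h1, h3⟩, h2⟩
  · rintro ⟨⟨g, h1, h3⟩, h2⟩
    exact ⟨g, ⟨h1, h2⟩, h3⟩

theorem depth_keep_le (S : Set α) (f : Forest α) : depth (keep S f) ≤ depth f := by
  have h := congrArg depth (keep_add_keep_compl S f)
  rw [depth_add] at h
  omega

/-- Merging the trees with root label `b` does not change the pathset. -/
theorem paths_keep_add_node_below {b : α} {f : Forest α} (hb : b ∈ labels f) :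
    paths (keep {b}ᶜ f + node b (below b f)) = paths f := by
  ext l
  cases l with
  | nil => simp [nil_mem_paths]
  | cons a l =>
    rw [paths_add, Set.mem_union, cons_mem_paths_keep, paths_node]
    by_cases h : a = b
    · subst h
      rw [cons_mem_paths_iff_below]
      simp [hb]
    · simp [h, Ne.symm h]

/-! ### The normal form is determined by the pathset -/

theorem roots_sum_node (s : Finset α) (k : α → Forest α) :
    roots (∑ b ∈ s, node b (k b)) = (fun b => (b, k b)) '' s := by
  classical
  induction s using Finset.induction_on with
  | empty => simp [roots_zero]
  | insert a s ha ih =>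
    rw [Finset.sum_insert ha, roots_add, roots_node, ih, Finset.coe_insert, Set.image_insert_eq]
    rfl

theorem roots_normalForm (f : Forest α) :
    roots (normalForm f) = (fun b => (b, normalForm (below b f))) '' labels f := by
  rw [normalForm_eq, roots_sum_node, (finite_labels f).coe_toFinset]

theorem labels_normalForm (f : Forest α) : labels (normalForm f) = labels f := by
  rw [labels, roots_normalForm, Set.image_image, Set.image_id']

theorem paths_normalForm (f : Forest α) : paths (normalForm f) = paths f := by
  induction hn : depth f using Nat.strong_induction_on generalizing f with
  | _ n ih =>
    subst hn
    ext l
    cases l with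
    | nil => simp [nil_mem_paths]
    | cons a l =>
      rw [cons_mem_paths, cons_mem_paths_iff_below, roots_normalForm]
      constructor
      · rintro ⟨_, ⟨b, hb, h⟩, hl⟩
        obtain ⟨rfl, rfl⟩ := Prod.mk.inj h
        exact ⟨hb, ih _ (depth_below_lt hb) _ rfl ▸ hl⟩
      · rintro ⟨ha, hl⟩
        exact ⟨_, ⟨a, ha, rfl⟩, (ih _ (depth_below_lt ha) _ rfl).symm ▸ hl⟩

theorem normalForm_congr {f g : Forest α} (h : paths f = paths g) :
    normalForm f = normalForm g := by
  induction hn : depth f using Nat.strong_induction_on generalizing f g with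
  | _ n ih =>
    subst hn
    refine ext_roots ?_
    rw [roots_normalForm, roots_normalForm, ← labels_eq_of_paths_eq h]
    refine Set.image_congr fun b hb => ?_
    rw [ih _ (depth_below_lt hb) (paths_below_eq h hb) rfl]

theorem normalForm_eq_iff {f g : Forest α} : normalForm f = normalForm g ↔ paths f = paths g :=
  ⟨fun h => by rw [← paths_normalForm f, h, paths_normalForm], normalForm_congr⟩

theorem haveCommonPathset_iff_normalForm (L₁ L₂ : Set (Forest α)) :
    HaveCommonPathset L₁ L₂ ↔ (normalForm '' L₁ ∩ normalForm '' L₂).Nonempty := by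
  constructor
  · rintro ⟨_, ⟨f, hf, rfl⟩, g, hg, h⟩
    exact ⟨_, ⟨f, hf, rfl⟩, g, hg, normalForm_congr h⟩
  · rintro ⟨_, ⟨f, hf, rfl⟩, g, hg, h⟩
    exact ⟨_, ⟨f, hf, rfl⟩, g, hg, normalForm_eq_iff.1 h⟩

/-! ### Relabelling and a local test for 2-distributivity -/

/-- Relabelling of a forest. -/
def map (k : α → β) : Forest α → Forest β := fold add_idem fun a _ x => node (k a) x

theorem map_zero (k : α → β) : map k 0 = 0 := rfl

theorem map_add (k : α → β) (f g : Forest α) : map k (f + g) = map k f + map k g :=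
  fold_add _ _ f g

theorem map_node (k : α → β) (a : α) (f : Forest α) : map k (node a f) = node (k a) (map k f) :=
  fold_node _ _ a f

theorem paths_map (k : α → β) (f : Forest α) : paths (map k f) = List.map k '' paths f := by
  induction f using Forest.induction with
  | zero => simp [map_zero, paths_zero]
  | add f g hf hg => rw [map_add, paths_add, hf, hg, paths_add, Set.image_union]
  | node a f ih =>
    rw [map_node, paths_node, paths_node, ih, Set.image_insert_eq, Set.image_image, Set.image_image]
    rfl

end Forest

section eval

variable {α : Type u} {β : Type v} {H : Type w} {V : Type z} [AddCommMonoid H] [Monoid V]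
  [ForestAlgebra H V]

theorem Forest.eval_zero (g : α → V) : (Forest.eval g (0 : Forest α) : H) = 0 := rfl

theorem Forest.eval_map (g : β → V) (k : α → β) (f : Forest α) :
    (Forest.eval g (Forest.map k f) : H) = Forest.eval (g ∘ k) f := by
  induction f using Forest.induction with
  | zero => rfl
  | add f f' hf hf' => rw [Forest.map_add, Forest.eval_add, Forest.eval_add, hf, hf']
  | node a f ih => rw [Forest.map_node, Forest.eval_node, Forest.eval_node, ih]; rfl

/-- The value of a forest at which a tree already present is added once more. -/
theorem Forest.eval_add_smul_of_mem (g : α → V) {f t : Forest α} {a : α} (h : (a, t) ∈ f.roots) :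
    (Forest.eval g f + g a • Forest.eval g t : H) = Forest.eval g f := by
  rw [← Forest.eval_node, ← Forest.eval_add, Forest.add_node_of_mem f h]

theorem Context.letter_smul (a : α) (f : Forest α) : Context.letter a • f = Forest.node a f :=
  (zero_add _).trans (congrArg _ (zero_add f))

/-- A morphism from the free forest algebra is determined by the images of the letters. -/
theorem ForestAlgebraHom.onForests_eq_eval (φ : ForestAlgebraHom (Forest α) (Context α) H V)
    (f : Forest α) :
    φ.onForests f = Forest.eval (fun a => φ.onContexts (Context.letter a)) f := by
  induction f using Forest.induction with
  | zero => exact map_zero _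
  | add f f' hf hf' => rw [_root_.map_add, hf, hf', Forest.eval_add]
  | node a f ih => rw [← Context.letter_smul, φ.map_smul, ih, Context.letter_smul, Forest.eval_node]

theorem haveCommonPathset_typeLanguage {h h' : H} :
    HaveCommonPathset (typeLanguage V h) (typeLanguage V h') ↔
      ∃ f f' : Forest V, f.paths = f'.paths ∧ Forest.eval id f = h ∧ Forest.eval id f' = h' := by
  constructor
  · rintro ⟨_, ⟨f, hf, rfl⟩, f', hf', e⟩
    exact ⟨f, f', e.symm, hf, hf'⟩
  · rintro ⟨f, f', e, hf, hf'⟩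
    exact ⟨_, ⟨f, hf, rfl⟩, f', hf', e.symm⟩

/-- 2-distributivity can be tested on pairs of forest types with a common pathset: every finite
alphabet can be relabelled by the images of its letters in `V`, and conversely `V`, being finite,
can serve as an alphabet itself. -/
theorem isTwoDistributive_iff [Finite V] :
    IsTwoDistributive H V ↔ ∀ h h' : H, HaveCommonPathset (typeLanguage V h) (typeLanguage V h') →
        ∀ v : V, v • (h + h') = v • h + v • h' := by
  simp only [haveCommonPathset_typeLanguage]
  constructor
  · rintro hd h h' ⟨f, f', e, rfl, rfl⟩ v
    obtain ⟨m, ⟨eV⟩⟩ := Finite.exists_equiv_fin V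
    have key := hd (Fin m) (ForestAlgebraHom.ofLetters H eV.symm) (Context.letter (eV v))
      (f.map eV) (f'.map eV) (by rw [Forest.paths_map, Forest.paths_map, e])
    have hev (t : Forest V) : (ForestAlgebraHom.ofLetters H eV.symm).onForests (t.map eV) =
        Forest.eval id t := by
      refine (Forest.eval_map _ _ t).trans ?_
      rw [Equiv.symm_comp_self]
    simpa only [ForestAlgebraHom.map_smul, map_add, hev, ForestAlgebraHom.ofLetters_letter,
      Equiv.symm_apply_apply] using key
  · intro hd A _ φ c f₁ f₂ e
    rw [map_add, φ.map_smul, φ.map_smul, φ.map_smul, map_add]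
    set k : A → V := fun a => φ.onContexts (Context.letter a)
    have hev (t : Forest A) : (Forest.eval id (t.map k) : H) = φ.onForests t := by
      rw [Forest.eval_map, φ.onForests_eq_eval]; rfl
    exact hd _ _ ⟨f₁.map k, f₂.map k, by rw [Forest.paths_map, Forest.paths_map, e], hev _, hev _⟩ _

end eval

/-! ### Families of forests with a given pathset -/

/-- `E = E₁ + E₂` for some way of adding elements of `E₁` and `E₂` that uses all of them. -/
def Set.Combines {M : Type u} [Add M] (E₁ E₂ E : Set M) : Prop :=
  (∀ e ∈ E, ∃ x ∈ E₁, ∃ y ∈ E₂, x + y = e) ∧ (∀ x ∈ E₁, ∃ y ∈ E₂, x + y ∈ E) ∧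
    ∀ y ∈ E₂, ∃ x ∈ E₁, x + y ∈ E

/-- All elements of `D` are sums of elements `v • x` with `x ∈ E`, and each `x ∈ E` can be used in
such a sum. -/
def Set.Spans {M : Type u} {V : Type v} [AddCommMonoid M] [SMul V M] (v : V) (E D : Set M) : Prop :=
  D ⊆ AddSubmonoid.closure ((v • ·) '' E) ∧
    ∀ x ∈ E, ∃ s ∈ AddSubmonoid.closure ((v • ·) '' E), s + v • x ∈ D

/-- `E` is the set of values of a family of forests whose pathsets have the union `π(p)`. The family
need not be finite; it is not empty, since the empty path belongs to `π(p)`. -/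
def Realizes {α : Type u} {H : Type v} {V : Type w} [AddCommMonoid H] [Monoid V] [ForestAlgebra H V]
    (g : α → V) (p : Forest α) (E : Set H) : Prop :=
  ∃ F : Set (Forest α), ⋃ f ∈ F, f.paths = p.paths ∧ Forest.eval g '' F = E

namespace Realizes

variable {α : Type u} {H : Type w} {V : Type z} [AddCommMonoid H] [Monoid V] [ForestAlgebra H V]
  {g : α → V}

theorem congr {p q : Forest α} (h : p.paths = q.paths) (E : Set H) :
    Realizes g p E ↔ Realizes g q E := by
  rw [Realizes, Realizes, h]

theorem paths_subset {F : Set (Forest α)} {P : Set (List α)} (h : ⋃ f ∈ F, f.paths = P)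
    {f : Forest α} (hf : f ∈ F) : f.paths ⊆ P := h ▸ Set.subset_biUnion_of_mem hf

theorem exists_mem {F : Set (Forest α)} {P : Set (List α)} (h : ⋃ f ∈ F, f.paths = P)
    {l : List α} (hl : l ∈ P) : ∃ f ∈ F, l ∈ f.paths := by
  rw [← h] at hl
  simpa using hl

theorem biUnion_eq {F : Set (Forest α)} {P : Set (List α)} (h : ∀ f ∈ F, f.paths ⊆ P)
    (h' : ∀ l ∈ P, ∃ f ∈ F, l ∈ f.paths) : ⋃ f ∈ F, f.paths = P := by
  refine Set.Subset.antisymm (Set.iUnion₂_subset h) fun l hl => ?_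
  simpa using h' l hl

theorem zero_iff {E : Set H} : Realizes g 0 E ↔ E = {0} := by
  constructor
  · rintro ⟨F, hF, rfl⟩
    have h0 : F = {0} := by
      refine Set.eq_singleton_iff_nonempty_unique_mem.2 ⟨?_, fun f hf => ?_⟩
      · obtain ⟨f, hf, _⟩ := exists_mem hF (Forest.nil_mem_paths 0)
        exact ⟨f, hf⟩
      · refine Forest.eq_zero_of_labels (Set.eq_empty_of_forall_notMem fun a ha => ?_)
        have := paths_subset hF hf (Forest.mem_labels_iff_mem_paths.1 ha)
        rw [Forest.paths_zero] at this
        simp at this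
    rw [h0, Set.image_singleton, Forest.eval_zero]
  · rintro rfl
    exact ⟨{0}, by simp, by rw [Set.image_singleton, Forest.eval_zero]⟩

theorem singleton_iff {p : Forest α} {h : H} :
    Realizes g p {h} ↔ ∃ f : Forest α, f.paths = p.paths ∧ Forest.eval g f = h := by
  constructor
  · rintro ⟨F, hF, hE⟩
    have hev (f : Forest α) (hf : f ∈ F) : Forest.eval g f = h := by
      have : (Forest.eval g f : H) ∈ Forest.eval g '' F := ⟨f, hf, rfl⟩
      rwa [hE] at this
    have hfin : p.paths.Finite := by
      clear hF
      induction p using Forest.induction with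
      | zero => rw [Forest.paths_zero]; exact Set.finite_singleton _
      | add p q hp hq => rw [Forest.paths_add]; exact hp.union hq
      | node a p hp => rw [Forest.paths_node]; exact (hp.image _).insert _
    -- Finitely many members of the family cover the pathset; since `H` is idempotent, their sum
    -- has the same value.
    have key (Q : Set (List α)) (hQ : Q.Finite) : Q ⊆ p.paths →
        ∃ f : Forest α, Q ⊆ f.paths ∧ f.paths ⊆ p.paths ∧ Forest.eval g f = h := by
      induction Q, hQ using Set.Finite.induction_on with
      | empty =>
        intro _
        obtain ⟨f, hf, _⟩ := exists_mem hF (Forest.nil_mem_paths p)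
        exact ⟨f, Set.empty_subset _, paths_subset hF hf, hev f hf⟩
      | @insert l Q _ _ ih =>
        intro hl
        obtain ⟨f, h1, h2, h3⟩ := ih ((Set.subset_insert _ _).trans hl)
        obtain ⟨f', hf', hl'⟩ := exists_mem hF (hl (Set.mem_insert _ _))
        refine ⟨f' + f, ?_, ?_, ?_⟩
        · rw [Forest.paths_add]
          exact Set.insert_subset (Or.inl hl') (h1.trans Set.subset_union_right)
        · rw [Forest.paths_add]
          exact Set.union_subset (paths_subset hF hf') h2
        · rw [Forest.eval_add, h3, hev f' hf', ForestAlgebra.add_idem V]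
    obtain ⟨f, h1, h2, h3⟩ := key _ hfin subset_rfl
    exact ⟨f, h2.antisymm h1, h3⟩
  · rintro ⟨f, hf, rfl⟩
    exact ⟨{f}, by simpa using hf, Set.image_singleton⟩

/-- A family with pathset `π(p + q)` splits into a family for `p` and a family for `q`, if `p` and
`q` have no root label in common. -/
theorem add_iff {p q : Forest α} (hd : Disjoint p.labels q.labels) {E : Set H} :
    Realizes g (p + q) E ↔
      ∃ E₁ E₂ : Set H, Realizes g p E₁ ∧ Realizes g q E₂ ∧ Set.Combines E₁ E₂ E := by
  constructor
  · rintro ⟨F, hF, rfl⟩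
    have hsplit (f : Forest α) : (Forest.eval g (f.keep p.labels) : H) +
        Forest.eval g (f.keep p.labelsᶜ) = Forest.eval g f := by
      rw [← Forest.eval_add, Forest.keep_add_keep_compl]
    have hmem (a : α) (l : List α) (P : Forest α) (h : a :: l ∈ P.paths) : a ∈ P.labels :=
      (Forest.cons_mem_paths_iff_below.1 h).1
    have hkeep (S : Set α) (P : Forest α) (hP : ∀ a l, a :: l ∈ P.paths ↔
        a :: l ∈ (p + q).paths ∧ a ∈ S) : ⋃ f ∈ Forest.keep S '' F, f.paths = P.paths := by
      refine biUnion_eq ?_ fun l hl => ?_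
      · rintro _ ⟨f, hf, rfl⟩ l hl
        cases l with
        | nil => exact Forest.nil_mem_paths _
        | cons a l =>
          rw [Forest.cons_mem_paths_keep] at hl
          exact (hP a l).2 ⟨paths_subset hF hf hl.1, hl.2⟩
      · cases l with
        | nil =>
          obtain ⟨f, hf, _⟩ := exists_mem hF (Forest.nil_mem_paths _)
          exact ⟨_, ⟨f, hf, rfl⟩, Forest.nil_mem_paths _⟩
        | cons a l =>
          rw [hP] at hl
          obtain ⟨f, hf, hl'⟩ := exists_mem hF hl.1
          exact ⟨_, ⟨f, hf, rfl⟩, Forest.cons_mem_paths_keep.2 ⟨hl', hl.2⟩⟩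
    refine ⟨Forest.eval g '' (Forest.keep p.labels '' F),
      Forest.eval g '' (Forest.keep p.labelsᶜ '' F), ⟨_, hkeep _ p fun a l => ?_, rfl⟩,
      ⟨_, hkeep _ q fun a l => ?_, rfl⟩, ?_, ?_, ?_⟩
    · rw [Forest.paths_add]
      exact ⟨fun h => ⟨Or.inl h, hmem _ _ _ h⟩, fun ⟨h, ha⟩ => h.resolve_right fun h' =>
        Set.disjoint_left.1 hd ha (hmem _ _ _ h')⟩
    · rw [Forest.paths_add]
      exact ⟨fun h => ⟨Or.inr h, fun ha => Set.disjoint_left.1 hd ha (hmem _ _ _ h)⟩,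
        fun ⟨h, ha⟩ => h.resolve_left fun h' => ha (hmem _ _ _ h')⟩
    · rintro _ ⟨f, hf, rfl⟩
      exact ⟨_, ⟨_, ⟨f, hf, rfl⟩, rfl⟩, _, ⟨_, ⟨f, hf, rfl⟩, rfl⟩, hsplit f⟩
    · rintro _ ⟨_, ⟨f, hf, rfl⟩, rfl⟩
      exact ⟨_, ⟨_, ⟨f, hf, rfl⟩, rfl⟩, f, hf, (hsplit f).symm⟩
    · rintro _ ⟨_, ⟨f, hf, rfl⟩, rfl⟩
      exact ⟨_, ⟨_, ⟨f, hf, rfl⟩, rfl⟩, f, hf, (hsplit f).symm⟩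
  · rintro ⟨_, _, ⟨F₁, hF₁, rfl⟩, ⟨F₂, hF₂, rfl⟩, h, h₁, h₂⟩
    refine ⟨{f | Forest.eval g f ∈ E ∧ ∃ f₁ ∈ F₁, ∃ f₂ ∈ F₂, f₁ + f₂ = f}, biUnion_eq ?_ ?_, ?_⟩
    · rintro _ ⟨_, f₁, hf₁, f₂, hf₂, rfl⟩
      rw [Forest.paths_add, Forest.paths_add]
      exact Set.union_subset_union (paths_subset hF₁ hf₁) (paths_subset hF₂ hf₂)
    · intro l hl
      rw [Forest.paths_add] at hl
      rcases hl with hl | hl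
      · obtain ⟨f₁, hf₁, hl⟩ := exists_mem hF₁ hl
        obtain ⟨_, ⟨f₂, hf₂, rfl⟩, hE⟩ := h₁ _ ⟨f₁, hf₁, rfl⟩
        refine ⟨f₁ + f₂, ⟨by rwa [Forest.eval_add], f₁, hf₁, f₂, hf₂, rfl⟩, ?_⟩
        rw [Forest.paths_add]
        exact Or.inl hl
      · obtain ⟨f₂, hf₂, hl⟩ := exists_mem hF₂ hl
        obtain ⟨_, ⟨f₁, hf₁, rfl⟩, hE⟩ := h₂ _ ⟨f₂, hf₂, rfl⟩
        refine ⟨f₁ + f₂, ⟨by rwa [Forest.eval_add], f₁, hf₁, f₂, hf₂, rfl⟩, ?_⟩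
        rw [Forest.paths_add]
        exact Or.inr hl
    · ext e
      constructor
      · rintro ⟨f, hf, rfl⟩
        exact hf.1
      · intro he
        obtain ⟨_, ⟨f₁, hf₁, rfl⟩, _, ⟨f₂, hf₂, rfl⟩, rfl⟩ := h e he
        rw [← Forest.eval_add] at he ⊢
        exact ⟨_, ⟨he, f₁, hf₁, f₂, hf₂, rfl⟩, rfl⟩

/-- A family with pathset `π(a[p])` arises from the family of all `t` such that `a[t]` is a tree of
one of its members. -/
theorem node_iff {a : α} {p : Forest α} {D : Set H} :
    Realizes g (Forest.node a p) D ↔ ∃ E : Set H, Realizes g p E ∧ Set.Spans (g a) E D := by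
  constructor
  · rintro ⟨F, hF, rfl⟩
    have hroot (f : Forest α) (hf : f ∈ F) (b : α) (l : List α) (hl : b :: l ∈ f.paths) :
        b = a ∧ l ∈ p.paths := by
      have := paths_subset hF hf hl
      rw [Forest.paths_node] at this
      simpa [and_comm, eq_comm] using this
    set G : Set (Forest α) := {t | ∃ f ∈ F, (a, t) ∈ f.roots}
    -- the value of a member of `F` is generated by the values of its trees
    have hval (f : Forest α) (hf : ∀ b t, (b, t) ∈ f.roots → b = a ∧ t ∈ G) :
        (Forest.eval g f : H) ∈
          AddSubmonoid.closure ((g a • ·) '' (Forest.eval g '' G) : Set H) := by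
      induction f using Forest.induction with
      | zero => exact zero_mem _
      | add f f' ih ih' =>
        rw [Forest.roots_add] at hf
        rw [Forest.eval_add]
        exact add_mem (ih fun b t h => hf b t (Or.inl h)) (ih' fun b t h => hf b t (Or.inr h))
      | node b t _ =>
        obtain ⟨rfl, ht⟩ := hf b t (by rw [Forest.roots_node]; rfl)
        rw [Forest.eval_node]
        exact AddSubmonoid.subset_closure ⟨_, ⟨t, ht, rfl⟩, rfl⟩
    have hval' (f : Forest α) (hf : f ∈ F) := hval f fun b t ht => by
      obtain ⟨rfl, _⟩ := hroot f hf b [] (Forest.cons_mem_paths.2 ⟨t, ht, Forest.nil_mem_paths t⟩)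
      exact ⟨rfl, f, hf, ht⟩
    refine ⟨Forest.eval g '' G, ⟨G, biUnion_eq ?_ fun l hl => ?_, rfl⟩, ?_, ?_⟩
    · rintro t ⟨f, hf, ht⟩ l hl
      exact (hroot f hf a l (Forest.cons_mem_paths.2 ⟨t, ht, hl⟩)).2
    · have hl' : a :: l ∈ (Forest.node a p).paths := by
        rw [Forest.paths_node]
        exact Or.inr ⟨l, hl, rfl⟩
      obtain ⟨f, hf, hl'⟩ := exists_mem hF hl'
      obtain ⟨t, ht, hl⟩ := Forest.cons_mem_paths.1 hl'
      exact ⟨t, ⟨f, hf, ht⟩, hl⟩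
    · rintro _ ⟨f, hf, rfl⟩
      exact hval' f hf
    · rintro _ ⟨t, ⟨f, hf, ht⟩, rfl⟩
      exact ⟨_, hval' f hf, f, hf, (Forest.eval_add_smul_of_mem g ht).symm⟩
  · rintro ⟨_, ⟨F, hF, rfl⟩, h₁, h₂⟩
    -- the sums of trees `a[t]` with `t ∈ F` have all possible values
    have hcl : ((AddSubmonoid.closure ((g a • ·) '' (Forest.eval g '' F)) : AddSubmonoid H) :
        Set H) = Forest.eval g '' (AddSubmonoid.closure (Forest.node a '' F) :
          AddSubmonoid (Forest α)) := by
      have := AddMonoidHom.map_mclosure (ForestAlgebraHom.ofLetters H g).onForests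
        (Forest.node a '' F)
      have him : (ForestAlgebraHom.ofLetters H g).onForests '' (Forest.node a '' F) =
          (g a • ·) '' (Forest.eval g '' F) := by
        rw [Set.image_image, Set.image_image]
        exact Set.image_congr fun t _ => Forest.eval_node g a t
      rw [him] at this
      rw [← this]
      rfl
    rw [hcl] at h₁
    have h₂' (t : Forest α) (ht : t ∈ F) : ∃ k ∈ AddSubmonoid.closure (Forest.node a '' F),
        Forest.eval g (k + Forest.node a t) ∈ D := by
      obtain ⟨s, hs, hD⟩ := h₂ _ ⟨t, ht, rfl⟩
      rw [← SetLike.mem_coe, hcl] at hs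
      obtain ⟨k, hk, rfl⟩ := hs
      exact ⟨k, hk, by rwa [Forest.eval_add, Forest.eval_node]⟩
    refine ⟨{k | k ∈ AddSubmonoid.closure (Forest.node a '' F) ∧ Forest.eval g k ∈ D},
      biUnion_eq ?_ ?_, ?_⟩
    · intro k hk
      replace hk := hk.1
      induction hk using AddSubmonoid.closure_induction with
      | mem k hk =>
        obtain ⟨t, ht, rfl⟩ := hk
        rw [Forest.paths_node, Forest.paths_node]
        exact Set.insert_subset_insert (Set.image_mono (paths_subset hF ht))
      | zero =>
        rw [Forest.paths_zero]
        exact Set.singleton_subset_iff.2 (Forest.nil_mem_paths _)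
      | add k k' _ _ ih ih' =>
        rw [Forest.paths_add]
        exact Set.union_subset ih ih'
    · intro l hl
      obtain ⟨t, ht, hlt⟩ : ∃ t ∈ F, l ∈ (Forest.node a t).paths := by
        rw [Forest.paths_node] at hl
        rcases hl with rfl | ⟨l, hl, rfl⟩
        · obtain ⟨t, ht, _⟩ := exists_mem hF (Forest.nil_mem_paths p)
          exact ⟨t, ht, Forest.nil_mem_paths _⟩
        · obtain ⟨t, ht, hl⟩ := exists_mem hF hl
          exact ⟨t, ht, by rw [Forest.paths_node]; exact Or.inr ⟨l, hl, rfl⟩⟩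
      obtain ⟨k, hk, hD⟩ := h₂' t ht
      refine ⟨_, ⟨add_mem hk (AddSubmonoid.subset_closure ⟨t, ht, rfl⟩), hD⟩, ?_⟩
      rw [Forest.paths_add]
      exact Or.inr hlt
    · ext e
      constructor
      · rintro ⟨f, hf, rfl⟩
        exact hf.2
      · intro he
        obtain ⟨k, hk, rfl⟩ := h₁ he
        exact ⟨k, ⟨hk, he⟩, rfl⟩

end Realizes

/-! ### Regularity of the language of normal forms -/

namespace Forest

variable {α : Type u}

theorem below_eq_zero {b : α} {f : Forest α} (h : b ∉ labels f) : below b f = 0 := by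
  refine eq_zero_of_labels (Set.eq_empty_of_forall_notMem fun c hc => ?_)
  obtain ⟨g, hg⟩ := mem_labels.1 hc
  obtain ⟨k, hk, _⟩ := mem_roots_below.1 hg
  exact h (mem_labels.2 ⟨k, hk⟩)

theorem normalForm_zero : normalForm (0 : Forest α) = 0 :=
  eq_zero_of_labels (by rw [labels_normalForm, labels_zero])

theorem normalForm_node (a : α) (f : Forest α) : normalForm (node a f) = node a (normalForm f) :=
  ext_roots (by
    rw [roots_normalForm, labels_node, roots_node, Set.image_singleton, below_node, if_pos rfl])

theorem normalForm_add {f g : Forest α} (h : Disjoint (labels f) (labels g)) :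
    normalForm (f + g) = normalForm f + normalForm g := by
  refine ext_roots ?_
  rw [roots_add, roots_normalForm, roots_normalForm, roots_normalForm, labels_add, Set.image_union]
  congr 1 <;> refine Set.image_congr fun b hb => ?_
  · rw [below_add, below_eq_zero (Set.disjoint_left.1 h hb), add_zero]
  · rw [below_add, below_eq_zero (Set.disjoint_right.1 h hb), zero_add]

end Forest

namespace ForestTerm

variable {α : Type u}

theorem labels_mk (t : ForestTerm α) : (Forest.mk t).labels = t.rootLabels := by
  induction t with
  | empty => exact Forest.labels_zero
  | add s t hs ht => rw [rootLabels, ← hs, ← ht, ← Forest.labels_add]; rfl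
  | node a t _ => exact Forest.labels_node a (Forest.mk t)

theorem Reduced.normalForm_mk {t : ForestTerm α} (h : t.Reduced) :
    (Forest.mk t).normalForm = Forest.mk t := by
  induction t with
  | empty => exact Forest.normalForm_zero
  | add s t hs ht =>
    obtain ⟨h₁, h₂, hd⟩ := h
    rw [← labels_mk, ← labels_mk] at hd
    refine (Forest.normalForm_add hd).trans ?_
    rw [hs h₁, ht h₂]
    rfl
  | node a t ht =>
    refine (Forest.normalForm_node a (Forest.mk t)).trans ?_
    rw [ht h]
    rfl

theorem mem_normalFormTerms {L : Set (Forest α)} {t : ForestTerm α} :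
    t ∈ normalFormTerms L ↔ t.Reduced ∧ ∃ f ∈ L, f.paths = (Forest.mk t).paths := by
  refine and_congr_right fun h => exists_congr fun f => and_congr_right fun _ => ?_
  rw [← Forest.normalForm_eq_iff, h.normalForm_mk]

/-- A language is regular if it is a union of classes of a finite congruence, given here as the
kernel of `κ`, that satisfies the laws of commutative monoids. -/
theorem isRegular_of_congruence {K : Set (ForestTerm α)} {N : Type} [Finite N]
    (κ : ForestTerm α → N)
    (add_congr : ∀ s s' t t' : ForestTerm α, κ s = κ s' → κ t = κ t' → κ (s.add t) = κ (s'.add t'))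
    (node_congr : ∀ a t t', κ t = κ t' → κ (node a t) = κ (node a t'))
    (assoc : ∀ r s t : ForestTerm α, κ ((r.add s).add t) = κ (r.add (s.add t)))
    (comm : ∀ s t : ForestTerm α, κ (s.add t) = κ (t.add s))
    (empty_add : ∀ t, κ (empty.add t) = κ t)
    (mem_congr : ∀ s t, κ s = κ t → s ∈ K → t ∈ K) : IsRegular K := by
  -- the states are the classes, represented by the values of `κ`
  let q (t : ForestTerm α) : Set.range κ := ⟨κ t, t, rfl⟩
  have hq (s t : ForestTerm α) : q s = q t ↔ κ s = κ t := Subtype.mk_eq_mk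
  have hsurj : Function.Surjective q := fun ⟨_, t, h⟩ => ⟨t, Subtype.ext h⟩
  have hrep (t : ForestTerm α) : κ (Function.surjInv hsurj (q t)) = κ t :=
    (hq _ _).1 (Function.surjInv_eq hsurj _)
  obtain ⟨plus, hplus⟩ : ∃ plus : Set.range κ → Set.range κ → Set.range κ,
      ∀ s t, plus (q s) (q t) = q (s.add t) :=
    ⟨fun x y => q ((Function.surjInv hsurj x).add (Function.surjInv hsurj y)),
      fun s t => (hq _ _).2 (add_congr _ _ _ _ (hrep s) (hrep t))⟩
  have plus_assoc (x y z : Set.range κ) : plus (plus x y) z = plus x (plus y z) := by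
    obtain ⟨r, rfl⟩ := hsurj x
    obtain ⟨s, rfl⟩ := hsurj y
    obtain ⟨t, rfl⟩ := hsurj z
    rw [hplus, hplus, hplus, hplus]
    exact (hq _ _).2 (assoc r s t)
  have plus_comm (x y : Set.range κ) : plus x y = plus y x := by
    obtain ⟨s, rfl⟩ := hsurj x
    obtain ⟨t, rfl⟩ := hsurj y
    rw [hplus, hplus]
    exact (hq _ _).2 (comm s t)
  have zero_plus (x : Set.range κ) : plus (q empty) x = x := by
    obtain ⟨t, rfl⟩ := hsurj x
    rw [hplus]
    exact (hq _ _).2 (empty_add t)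
  let instM : AddCommMonoid (Set.range κ) :=
    { add := plus
      zero := q empty
      add_assoc := plus_assoc
      zero_add := zero_plus
      add_zero := fun x => (plus_comm x _).trans (zero_plus x)
      add_comm := plus_comm
      nsmul := @nsmulRec _ ⟨q empty⟩ ⟨plus⟩ }
  let δ (a : α) (x : Set.range κ) : Set.range κ := q (node a (Function.surjInv hsurj x))
  have hrun (t : ForestTerm α) : run δ t = q t := by
    induction t with
    | empty => rfl
    | add s t hs ht => rw [run, hs, ht]; exact hplus s t
    | node a t ht => rw [run, ht]; exact (hq _ _).2 (node_congr a _ _ (hrep t))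
  refine ⟨Set.range κ, instM, δ, q '' K, inferInstance, fun t => ?_⟩
  rw [hrun]
  exact ⟨fun h => ⟨t, h, rfl⟩, fun ⟨s, hs, h⟩ => mem_congr s t ((hq s t).1 h) hs⟩

section Invariant

variable {H : Type w} {V : Type z} [AddCommMonoid H] [Monoid V] [ForestAlgebra H V]

open Classical in
/-- The information on an expression that an automaton for normal forms keeps: whether the
expression is reduced and, if it is, its root labels and the sets of values realized by families of
forests with its pathset. -/
noncomputable def invariant (H : Type w) {V : Type z} [AddCommMonoid H] [Monoid V]
    [ForestAlgebra H V] {ι : Type v} (k : α ≃ ι) (g : α → V) (t : ForestTerm α) :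
    Option (Set ι × Set (Set H)) :=
  if t.Reduced then some (k '' t.rootLabels, {E | Realizes g (Forest.mk t) E}) else none

variable {ι : Type v} {k : α ≃ ι} {g : α → V}

theorem invariant_eq_iff {s t : ForestTerm α} : invariant H k g s = invariant H k g t ↔
    (s.Reduced ↔ t.Reduced) ∧ (s.Reduced → s.rootLabels = t.rootLabels ∧
      ∀ E : Set H, Realizes g (Forest.mk s) E ↔ Realizes g (Forest.mk t) E) := by
  unfold invariant
  by_cases hs : s.Reduced <;> by_cases ht : t.Reduced <;>
    simp [hs, ht, k.injective.image_injective.eq_iff, Set.ofPred_inj,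
      funext_iff]

theorem invariant_add_congr {s s' t t' : ForestTerm α}
    (hs : invariant H k g s = invariant H k g s') (ht : invariant H k g t = invariant H k g t') :
    invariant H k g (s.add t) = invariant H k g (s'.add t') := by
  rw [invariant_eq_iff] at hs ht ⊢
  obtain ⟨hs₁, hs₂⟩ := hs
  obtain ⟨ht₁, ht₂⟩ := ht
  have hred : (s.add t).Reduced ↔ (s'.add t').Reduced := by
    simp only [Reduced]
    rw [← hs₁, ← ht₁]
    refine and_congr_right fun h => and_congr_right fun h' => ?_
    rw [(hs₂ h).1, (ht₂ h').1]
  refine ⟨hred, fun h => ?_⟩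
  have h' := hred.1 h
  obtain ⟨hls, hEs⟩ := hs₂ h.1
  obtain ⟨hlt, hEt⟩ := ht₂ h.2.1
  refine ⟨by rw [rootLabels, rootLabels, hls, hlt], fun E => ?_⟩
  have hd := h.2.2
  have hd' := h'.2.2
  rw [← labels_mk, ← labels_mk] at hd hd'
  change Realizes g (Forest.mk s + Forest.mk t) E ↔ Realizes g (Forest.mk s' + Forest.mk t') E
  rw [Realizes.add_iff hd, Realizes.add_iff hd']
  simp only [hEs, hEt]

theorem invariant_node_congr (a : α) {t t' : ForestTerm α}
    (h : invariant H k g t = invariant H k g t') :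
    invariant H k g (node a t) = invariant H k g (node a t') := by
  rw [invariant_eq_iff] at h ⊢
  refine ⟨h.1, fun ht => ⟨rfl, fun E => ?_⟩⟩
  change Realizes g (Forest.node a (Forest.mk t)) E ↔ Realizes g (Forest.node a (Forest.mk t')) E
  rw [Realizes.node_iff, Realizes.node_iff]
  simp only [(h.2 ht).2]

/-- The invariant respects the laws of commutative monoids, although not idempotency. -/
theorem invariant_eq_of_same {s t : ForestTerm α} (hr : s.Reduced ↔ t.Reduced)
    (h : Forest.mk s = Forest.mk t) : invariant H k g s = invariant H k g t :=
  invariant_eq_iff.2 ⟨hr, fun _ => ⟨by rw [← labels_mk, h, labels_mk], fun E => by rw [h]⟩⟩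

end Invariant

theorem isRegular_normalFormTerms [Finite α] {L : Set (Forest α)}
    (hL : IsRegularForestLanguage L) : IsRegular (normalFormTerms L) := by
  obtain ⟨H, V, _, _, _, φ, _, _, hφ⟩ := hL
  obtain ⟨n, ⟨k⟩⟩ := Finite.exists_equiv_fin α
  set g : α → V := fun a => φ.onContexts (Context.letter a)
  refine isRegular_of_congruence (invariant H k g) (fun _ _ _ _ => invariant_add_congr)
    (fun a _ _ => invariant_node_congr a) (fun r s t => ?_) (fun s t => ?_) (fun t => ?_)
    fun s t h hs => ?_
  · refine invariant_eq_of_same ?_ (Quotient.sound (.assoc r s t))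
    simp only [Reduced, rootLabels, Set.disjoint_union_left, Set.disjoint_union_right]
    tauto
  · refine invariant_eq_of_same ?_ (Quotient.sound (.comm s t))
    simp only [Reduced, disjoint_comm]
    tauto
  · refine invariant_eq_of_same ?_ (Quotient.sound (.empty_add t))
    simp [Reduced, rootLabels]
  · rw [mem_normalFormTerms] at hs ⊢
    rw [invariant_eq_iff] at h
    obtain ⟨hs, f, hf, hp⟩ := hs
    refine ⟨h.1.1 hs, ?_⟩
    have hreal : Realizes g (Forest.mk s) {φ.onForests f} :=
      Realizes.singleton_iff.2 ⟨f, hp, (φ.onForests_eq_eval f).symm⟩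
    obtain ⟨f', hp', hf'⟩ := Realizes.singleton_iff.1 (((h.2 hs).2 _).1 hreal)
    refine ⟨f', ?_, hp'⟩
    rw [hφ]
    exact ⟨f, hf, by rw [← hf', φ.onForests_eq_eval f']⟩

end ForestTerm

/-! ### Common pathsets as a formula with bounded quantifiers -/

namespace OperationTables

/-- The entry in row `i` and column `j` of a table. -/
def entry (R : List (List ℕ)) (i j : ℕ) : ℕ := (R.getD i []).getD j 0

/-- `z` is the number of a neutral element of the first table. -/
def IsZero (T : OperationTables) (z : ℕ) : Prop := ∀ i < T.1.length, entry T.1 z i = i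

/-- `Set.Combines` for the sets of forest types with the bit patterns `x`, `y`, `e`. -/
def Combines (T : OperationTables) (x y e : ℕ) : Prop :=
  (∀ k < T.1.length, e.testBit k = true → ∃ i < T.1.length, x.testBit i = true ∧
      ∃ j < T.1.length, y.testBit j = true ∧ entry T.1 i j = k) ∧
    (∀ i < T.1.length, x.testBit i = true →
      ∃ j < T.1.length, y.testBit j = true ∧ e.testBit (entry T.1 i j) = true) ∧
    ∀ j < T.1.length, y.testBit j = true →
      ∃ i < T.1.length, x.testBit i = true ∧ e.testBit (entry T.1 i j) = true

/-- The set with bit pattern `s` contains `0` and is closed under adding `a • j` for the elements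
`j` of the set with bit pattern `x`. -/
def Closed (T : OperationTables) (a x s : ℕ) : Prop :=
  (∀ k < T.1.length, IsZero T k → s.testBit k = true) ∧
    ∀ i < T.1.length, s.testBit i = true → ∀ j < T.1.length, x.testBit j = true →
      s.testBit (entry T.1 i (entry T.2.2 a j)) = true

/-- `Set.Spans` for the sets of forest types with the bit patterns `x` and `d`. -/
def Spans (T : OperationTables) (a x d : ℕ) : Prop :=
  ∃ s < 2 ^ T.1.length, Closed T a x s ∧
    (∀ t < 2 ^ T.1.length, Closed T a x t →
      ∀ i < T.1.length, s.testBit i = true → t.testBit i = true) ∧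
    (∀ i < T.1.length, d.testBit i = true → s.testBit i = true) ∧
    ∀ j < T.1.length, x.testBit j = true → ∃ i < T.1.length, s.testBit i = true ∧
      d.testBit (entry T.1 i (entry T.2.2 a j)) = true

/-- If `x` is realized by `p`, where `a` is not a root label of `p`, and `y` is realized by `q`, then
`e` is realized by `p + a[q]`, and all sets realized by `p + a[q]` arise in this way. -/
def Step (T : OperationTables) (a x y e : ℕ) : Prop :=
  ∃ d < 2 ^ T.1.length, Spans T a y d ∧ Combines T x d e

/-- The position of the triple `(j, x, y)` in a bit pattern. -/
def position (j x y : ℕ) : ℕ := Nat.pair j (Nat.pair x y)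

/-- The set of triples with bit pattern `I` contains `(0, {0}, {0})`, is closed under raising `j`,
and is closed under adding a tree with root label `j` to both families of a triple `(j, x, x')`; the
forests below this root are given by a triple `(m, y, y')`, where `m` is the number of letters.
Since the root labels are added in increasing order, no two of them are equal. -/
def Invariant (T : OperationTables) (I : ℕ) : Prop :=
  (∀ k < T.1.length, IsZero T k → I.testBit (position 0 (2 ^ k) (2 ^ k)) = true) ∧
    (∀ j < T.2.1.length, ∀ x < 2 ^ T.1.length, ∀ x' < 2 ^ T.1.length,
      I.testBit (position j x x') = true → I.testBit (position (j + 1) x x') = true) ∧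
    ∀ j < T.2.1.length, ∀ x < 2 ^ T.1.length, ∀ x' < 2 ^ T.1.length,
      I.testBit (position j x x') = true → ∀ y < 2 ^ T.1.length, ∀ y' < 2 ^ T.1.length,
        I.testBit (position T.2.1.length y y') = true → ∀ e < 2 ^ T.1.length, Step T j x y e →
          ∀ e' < 2 ^ T.1.length, Step T j x' y' e' →
            I.testBit (position (j + 1) e e') = true

/-- The forest types with numbers `h` and `h'` have a common pathset. -/
def CommonPathset (T : OperationTables) (h h' : ℕ) : Prop :=
  ∀ I < 2 ^ position (T.2.1.length + 1) (2 ^ T.1.length) (2 ^ T.1.length),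
    Invariant T I → I.testBit (position T.2.1.length (2 ^ h) (2 ^ h')) = true

end OperationTables

theorem Set.spans_iff {M : Type u} {V : Type v} [AddCommMonoid M] [SMul V M] {v : V} {E D : Set M} :
    Set.Spans v E D ↔ ∃ S : Set M, (0 ∈ S ∧ ∀ i ∈ S, ∀ j ∈ E, i + v • j ∈ S) ∧
      (∀ T : Set M, (0 ∈ T ∧ ∀ i ∈ T, ∀ j ∈ E, i + v • j ∈ T) → S ⊆ T) ∧
      D ⊆ S ∧ ∀ j ∈ E, ∃ i ∈ S, i + v • j ∈ D := by
  set C := AddSubmonoid.closure ((v • ·) '' E)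
  have hC : (0 : M) ∈ C ∧ ∀ i ∈ C, ∀ j ∈ E, i + v • j ∈ C :=
    ⟨zero_mem _, fun i hi j hj => add_mem hi (AddSubmonoid.subset_closure ⟨j, hj, rfl⟩)⟩
  have hmin (T : Set M) (hT : 0 ∈ T ∧ ∀ i ∈ T, ∀ j ∈ E, i + v • j ∈ T) : (C : Set M) ⊆ T := by
    intro x hx
    induction hx using AddSubmonoid.closure_induction_right with
    | zero => exact hT.1
    | add_right x hx y hy ih =>
      obtain ⟨j, hj, rfl⟩ := hy
      exact hT.2 _ ih j hj
  constructor
  · rintro ⟨h₁, h₂⟩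
    exact ⟨C, hC, hmin, h₁, h₂⟩
  · rintro ⟨S, hS, hS', h₁, h₂⟩
    obtain rfl : S = C := (hS' _ hC).antisymm (hmin _ hS)
    exact ⟨h₁, h₂⟩

section Bits

variable {X : Type u} {n : ℕ} (e : X ≃ Fin n)

theorem forall_lt_iff_forall {p : ℕ → Prop} :
    (∀ i < n, p i) ↔ ∀ x, p (e x) :=
  ⟨fun h x => h _ (e x).2, fun h i hi => by simpa using h (e.symm ⟨i, hi⟩)⟩

theorem exists_lt_iff_exists {p : ℕ → Prop} :
    (∃ i < n, p i) ↔ ∃ x, p (e x) :=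
  ⟨fun ⟨i, hi, h⟩ => ⟨e.symm ⟨i, hi⟩, by simpa using h⟩, fun ⟨x, h⟩ => ⟨_, (e x).2, h⟩⟩

/-- The set with bit pattern `x`. -/
def decodeSet (x : ℕ) : Set X := {h | x.testBit (e h) = true}

theorem exists_testBit (N : ℕ) (p : ℕ → Prop) :
    ∃ x < 2 ^ N, ∀ i < N, x.testBit i = true ↔ p i := by
  classical
  exact ⟨Nat.ofBits fun i : Fin N => decide (p i), Nat.ofBits_lt_two_pow _, fun i hi => by
    rw [Nat.testBit_ofBits_lt _ _ hi, decide_eq_true_iff]⟩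

theorem exists_decodeSet (S : Set X) : ∃ x < 2 ^ n, decodeSet e x = S := by
  obtain ⟨x, hx, h⟩ := exists_testBit n fun i => ∃ h ∈ S, (e h : ℕ) = i
  refine ⟨x, hx, Set.ext fun k => ?_⟩
  rw [decodeSet, Set.mem_ofPred_eq, h _ (e k).2]
  constructor
  · rintro ⟨k', hk', he⟩
    rwa [← e.injective (Fin.ext he)]
  · exact fun hk => ⟨k, hk, rfl⟩

theorem forall_decodeSet {p : Set X → Prop} : (∀ x < 2 ^ n, p (decodeSet e x)) ↔ ∀ S, p S :=
  ⟨fun h S => by obtain ⟨x, hx, rfl⟩ := exists_decodeSet e S; exact h x hx, fun h x _ => h _⟩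

theorem exists_iff_decodeSet {p : Set X → Prop} : (∃ x < 2 ^ n, p (decodeSet e x)) ↔ ∃ S, p S :=
  ⟨fun ⟨_, _, h⟩ => ⟨_, h⟩, fun ⟨S, h⟩ => by
    obtain ⟨x, hx, rfl⟩ := exists_decodeSet e S; exact ⟨x, hx, h⟩⟩

theorem decodeSet_injOn {x y : ℕ} (hx : x < 2 ^ n) (hy : y < 2 ^ n)
    (h : decodeSet e x = decodeSet e y) : x = y := by
  refine Nat.eq_of_testBit_eq fun i => ?_
  by_cases hi : i < n
  · have := Set.ext_iff.1 h (e.symm ⟨i, hi⟩)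
    rw [Bool.eq_iff_iff]
    simpa [decodeSet] using this
  · have h2 : 2 ^ n ≤ 2 ^ i := Nat.pow_le_pow_right (by norm_num) (not_lt.1 hi)
    rw [Nat.testBit_eq_false_of_lt (hx.trans_le h2), Nat.testBit_eq_false_of_lt (hy.trans_le h2)]

theorem decodeSet_two_pow (h : X) : decodeSet e (2 ^ (e h : ℕ)) = {h} := by
  ext k
  simp [decodeSet, Nat.testBit_two_pow, Fin.val_inj, eq_comm]

theorem two_pow_lt (h : X) : 2 ^ (e h : ℕ) < 2 ^ n :=
  Nat.pow_lt_pow_right (by norm_num) (e h).2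

end Bits

section Coding

open OperationTables

variable {H : Type u} {V : Type v} [AddCommMonoid H] [Monoid V] [ForestAlgebra H V] {n m : ℕ}
  (eH : H ≃ Fin n) (eV : V ≃ Fin m)

theorem entry_ofFn {a b : ℕ} (k : Fin a → Fin b → ℕ) (i : Fin a) (j : Fin b) :
    entry (List.ofFn fun i => List.ofFn fun j => k i j) i j = k i j := by
  simp [entry, List.getD_eq_getElem?_getD]

theorem length_operationTables : (operationTables eH eV).1.length = n := List.length_ofFn

theorem length_operationTables_mul : (operationTables eH eV).2.1.length = m := List.length_ofFn

theorem entry_add (h h' : H) : entry (operationTables eH eV).1 (eH h) (eH h') = eH (h + h') := by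
  simp [operationTables, entry_ofFn]

theorem entry_mul (v w : V) : entry (operationTables eH eV).2.1 (eV v) (eV w) = eV (v * w) := by
  simp [operationTables, entry_ofFn]

theorem entry_smul (v : V) (h : H) :
    entry (operationTables eH eV).2.2 (eV v) (eH h) = eH (v • h) := by
  simp [operationTables, entry_ofFn]

theorem isZero_iff (h : H) : IsZero (operationTables eH eV) (eH h) ↔ h = 0 := by
  rw [IsZero, length_operationTables, forall_lt_iff_forall eH]
  simp only [entry_add, Fin.val_inj, eH.injective.eq_iff]
  exact ⟨fun h' => by simpa using h' 0, fun e x => by rw [e, zero_add]⟩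

theorem combines_iff (x y e : ℕ) : Combines (operationTables eH eV) x y e ↔
    Set.Combines (decodeSet eH x) (decodeSet eH y) (decodeSet eH e) := by
  rw [Combines, length_operationTables]
  simp only [forall_lt_iff_forall eH, exists_lt_iff_exists eH, entry_add, Fin.val_inj,
    eH.injective.eq_iff]
  rfl

theorem closed_iff (v : V) (x s : ℕ) : Closed (operationTables eH eV) (eV v) x s ↔
    0 ∈ decodeSet eH s ∧ ∀ i ∈ decodeSet eH s, ∀ j ∈ decodeSet eH x,
      i + v • j ∈ decodeSet eH s := by
  rw [Closed, length_operationTables]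
  simp only [forall_lt_iff_forall eH, entry_smul, entry_add, isZero_iff, forall_eq]
  rfl

theorem spans_iff (v : V) (x d : ℕ) : Spans (operationTables eH eV) (eV v) x d ↔
    Set.Spans v (decodeSet eH x) (decodeSet eH d) := by
  rw [Spans, length_operationTables, Set.spans_iff, ← exists_iff_decodeSet eH]
  refine exists_congr fun s => and_congr_right fun _ => ?_
  rw [← forall_decodeSet eH]
  simp only [forall_lt_iff_forall eH, exists_lt_iff_exists eH, entry_smul, entry_add, closed_iff]
  rfl

theorem step_iff (v : V) (x y e : ℕ) : Step (operationTables eH eV) (eV v) x y e ↔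
    ∃ D, Set.Spans v (decodeSet eH y) D ∧ Set.Combines (decodeSet eH x) D (decodeSet eH e) := by
  rw [Step, length_operationTables, ← exists_iff_decodeSet eH]
  simp only [spans_iff, combines_iff]

theorem realizes_add_node_iff {A : Type w} {g : A → V} {a : A} {p q : Forest A} {E : Set H}
    (ha : a ∉ p.labels) : Realizes g (p + Forest.node a q) E ↔
      ∃ E₁ E₂ D : Set H, Realizes g p E₁ ∧ Realizes g q E₂ ∧ Set.Spans (g a) E₂ D ∧
        Set.Combines E₁ D E := by
  rw [Realizes.add_iff (by rw [Forest.labels_node]; exact Set.disjoint_singleton_right.2 ha)]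
  simp only [Realizes.node_iff]
  constructor
  · rintro ⟨E₁, D, h₁, ⟨E₂, h₂, h₃⟩, h₄⟩
    exact ⟨E₁, E₂, D, h₁, h₂, h₃, h₄⟩
  · rintro ⟨E₁, E₂, D, h₁, h₂, h₃, h₄⟩
    exact ⟨E₁, D, h₁, ⟨E₂, h₂, h₃⟩, h₄⟩

/-- An invariant contains the triples `(j, x, y)` it is meant to contain. The induction is on the
depth of the pathset, and then on `j`; trees with equal root labels may be merged, since only the
pathset matters. -/
theorem testBit_of_invariant {I : ℕ} (hI : Invariant (operationTables eH eV) I) (p : Forest V)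
    {j : ℕ} (hj : j ≤ m) (hp : ∀ v ∈ p.labels, (eV v : ℕ) < j) {x x' : ℕ} (hx : x < 2 ^ n)
    (hx' : x' < 2 ^ n) (h : Realizes id p (decodeSet eH x)) (h' : Realizes id p (decodeSet eH x')) :
    I.testBit (position j x x') = true := by
  induction hd : p.depth using Nat.strong_induction_on generalizing p j x x' with
  | _ d ihd =>
  subst hd
  obtain ⟨hbase, hskip, hstep⟩ := hI
  rw [length_operationTables] at hbase hskip hstep
  rw [length_operationTables_mul] at hskip hstep
  induction j generalizing p x x' with
  | zero =>
    obtain rfl : p = 0 := Forest.eq_zero_of_labels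
      (Set.eq_empty_of_forall_notMem fun v hv => Nat.not_lt_zero _ (hp v hv))
    rw [Realizes.zero_iff, ← decodeSet_two_pow eH] at h h'
    rw [decodeSet_injOn eH hx (two_pow_lt eH 0) h, decodeSet_injOn eH hx' (two_pow_lt eH 0) h']
    exact hbase _ (eH 0).2 ((isZero_iff eH eV 0).2 rfl)
  | succ j ih =>
    obtain ⟨a, ha⟩ : ∃ a, eV a = ⟨j, hj⟩ := eV.surjective _
    have ha : (eV a : ℕ) = j := congrArg Fin.val ha
    by_cases hap : a ∈ p.labels
    · have hpaths := Forest.paths_keep_add_node_below hap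
      have hna : a ∉ (p.keep {a}ᶜ).labels := by
        rw [Forest.labels_keep]
        exact fun h => h.2 rfl
      rw [← Realizes.congr hpaths, realizes_add_node_iff hna] at h h'
      obtain ⟨E₁, E₂, D, h₁, h₂, h₃, h₄⟩ := h
      obtain ⟨E₁', E₂', D', h₁', h₂', h₃', h₄'⟩ := h'
      obtain ⟨y, hy, rfl⟩ := exists_decodeSet eH E₁
      obtain ⟨y', hy', rfl⟩ := exists_decodeSet eH E₁'
      obtain ⟨k, hk, rfl⟩ := exists_decodeSet eH E₂
      obtain ⟨k', hk', rfl⟩ := exists_decodeSet eH E₂'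
      refine hstep j hj y hy y' hy' (ih (p.keep {a}ᶜ) (Nat.le_of_succ_le hj) (fun v hv => ?_)
        hy hy' h₁ h₁' fun d hd q => ?_) k hk k' hk' ?_ x hx ?_ x' hx' ?_
      · rw [Forest.labels_keep] at hv
        have hne : (eV v : ℕ) ≠ j := fun e => hv.2 (eV.injective (Fin.ext (e.trans ha.symm)))
        have := hp v hv.1
        omega
      · exact ihd d (hd.trans_le (Forest.depth_keep_le _ _)) q
      · exact ihd _ (Forest.depth_below_lt hap) _ le_rfl (fun v _ => (eV v).2) hk hk' h₂ h₂' rfl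
      · rw [← ha, step_iff]
        exact ⟨D, h₃, h₄⟩
      · rw [← ha, step_iff]
        exact ⟨D', h₃', h₄'⟩
    · refine hskip j hj x hx x' hx' (ih p (Nat.le_of_succ_le hj) (fun v hv => ?_) hx hx' h h' ihd)
      have hne : (eV v : ℕ) ≠ j := fun e => hap (eV.injective (Fin.ext (e.trans ha.symm)) ▸ hv)
      have := hp v hv
      omega

theorem position_lt {j x x' j₀ N : ℕ} (hj : j < j₀) (hx : x < N) (hx' : x' < N) :
    position j x x' < position j₀ N N :=
  (Nat.pair_lt_pair_left _ hj).trans (Nat.pair_lt_pair_right _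
    ((Nat.pair_lt_pair_left _ hx).trans (Nat.pair_lt_pair_right _ hx')))

/-- The formula `CommonPathset` is correct: the least invariant consists of the triples `(j, x, y)`
such that `x` and `y` are realized by families with a common pathset whose root labels are less
than `j`. -/
theorem commonPathset_iff (h h' : H) :
    CommonPathset (operationTables eH eV) (eH h) (eH h') ↔
      HaveCommonPathset (typeLanguage V h) (typeLanguage V h') := by
  rw [haveCommonPathset_typeLanguage, CommonPathset, length_operationTables,
    length_operationTables_mul]
  constructor
  · intro hc
    obtain ⟨I, hI, hbit⟩ := exists_testBit (position (m + 1) (2 ^ n) (2 ^ n)) fun i =>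
      ∃ p : Forest V, (∀ v ∈ p.labels, (eV v : ℕ) < i.unpair.1) ∧
        Realizes id p (decodeSet eH i.unpair.2.unpair.1) ∧
        Realizes id p (decodeSet eH i.unpair.2.unpair.2)
    have hbit' {j x x' : ℕ} (hj : j < m + 1) (hx : x < 2 ^ n) (hx' : x' < 2 ^ n) :
        I.testBit (position j x x') = true ↔ ∃ p : Forest V, (∀ v ∈ p.labels, (eV v : ℕ) < j) ∧
          Realizes id p (decodeSet eH x) ∧ Realizes id p (decodeSet eH x') := by
      rw [hbit _ (position_lt hj hx hx')]
      simp only [position, Nat.unpair_pair]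
    have hinv : Invariant (operationTables eH eV) I := by
      rw [Invariant, length_operationTables, length_operationTables_mul]
      refine ⟨?_, ?_, ?_⟩
      · rw [forall_lt_iff_forall eH]
        intro z hz
        rw [isZero_iff] at hz
        subst hz
        rw [hbit' (Nat.succ_pos _) (two_pow_lt eH 0) (two_pow_lt eH 0), decodeSet_two_pow]
        exact ⟨0, by simp [Forest.labels_zero], Realizes.zero_iff.2 rfl, Realizes.zero_iff.2 rfl⟩
      · intro j hj x hx x' hx'
        rw [hbit' (by omega) hx hx', hbit' (by omega) hx hx']
        rintro ⟨p, hp, h₁⟩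
        exact ⟨p, fun v hv => Nat.lt_succ_of_lt (hp v hv), h₁⟩
      · rw [forall_lt_iff_forall eV]
        intro a x hx x' hx' hxx y hy y' hy' hyy e he hs e' he' hs'
        have ha := (eV a).2
        rw [hbit' (by omega) hx hx'] at hxx
        rw [hbit' (by omega) hy hy'] at hyy
        rw [hbit' (by omega) he he']
        rw [step_iff] at hs hs'
        obtain ⟨p, hp, h₁, h₁'⟩ := hxx
        obtain ⟨q, _, h₂, h₂'⟩ := hyy
        obtain ⟨D, h₃, h₄⟩ := hs
        obtain ⟨D', h₃', h₄'⟩ := hs'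
        have hap : a ∉ p.labels := fun h => lt_irrefl _ (hp a h)
        refine ⟨p + Forest.node a q, fun v hv => ?_, ?_, ?_⟩
        · rw [Forest.labels_add, Forest.labels_node] at hv
          rcases hv with hv | rfl
          · exact Nat.lt_succ_of_lt (hp v hv)
          · exact Nat.lt_succ_self _
        · exact (realizes_add_node_iff hap).2 ⟨_, _, D, h₁, h₂, h₃, h₄⟩
        · exact (realizes_add_node_iff hap).2 ⟨_, _, D', h₁', h₂', h₃', h₄'⟩
    have := hc I hI hinv
    rw [hbit' (Nat.lt_succ_self m) (two_pow_lt eH h) (two_pow_lt eH h'), decodeSet_two_pow,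
      decodeSet_two_pow] at this
    obtain ⟨p, _, h₁, h₂⟩ := this
    obtain ⟨f, hf, hfv⟩ := Realizes.singleton_iff.1 h₁
    obtain ⟨f', hf', hfv'⟩ := Realizes.singleton_iff.1 h₂
    exact ⟨f, f', hf.trans hf'.symm, hfv, hfv'⟩
  · rintro ⟨f, f', hf, hfv, hfv'⟩ I _ hI
    refine testBit_of_invariant eH eV hI f le_rfl (fun v _ => (eV v).2) (two_pow_lt eH h)
      (two_pow_lt eH h') ?_ ?_
    · rw [decodeSet_two_pow]
      exact Realizes.singleton_iff.2 ⟨f, rfl, hfv⟩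
    · rw [decodeSet_two_pow]
      exact Realizes.singleton_iff.2 ⟨f', hf.symm, hfv'⟩

end Coding

/-! ### Bounded quantification is primitive recursive -/

section Primrec

open OperationTables

variable {α : Type u} [Primcodable α]

theorem PrimrecPred.imp {p q : α → Prop} (hp : PrimrecPred p) (hq : PrimrecPred q) :
    PrimrecPred fun a => p a → q a :=
  (hp.not.or hq).of_eq fun _ => imp_iff_not_or.symm

theorem PrimrecPred.ball_lt {b : α → ℕ} {p : α → ℕ → Prop} (hb : Primrec b)
    (hp : PrimrecPred fun q : α × ℕ => p q.1 q.2) : PrimrecPred fun a => ∀ x < b a, p a x :=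
  (PrimrecRel.comp (PrimrecRel.forall_mem_list (R := fun (x : ℕ) (a : α) => p a x)
    (hp.comp (Primrec.snd.pair Primrec.fst))) (Primrec.list_range.comp hb) Primrec.id).of_eq
      fun a => by simp

theorem PrimrecPred.bex_lt {b : α → ℕ} {p : α → ℕ → Prop} (hb : Primrec b)
    (hp : PrimrecPred fun q : α × ℕ => p q.1 q.2) : PrimrecPred fun a => ∃ x < b a, p a x :=
  (PrimrecRel.comp (PrimrecRel.exists_mem_list (R := fun (x : ℕ) (a : α) => p a x)
    (hp.comp (Primrec.snd.pair Primrec.fst))) (Primrec.list_range.comp hb) Primrec.id).of_eq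
      fun a => by simp

theorem Primrec.fun_id : Primrec fun a : α => a := Primrec.id

theorem PrimrecPred.eq {f g : α → ℕ} (hf : Primrec f) (hg : Primrec g) :
    PrimrecPred fun a => f a = g a :=
  Primrec.eq.comp hf hg

theorem PrimrecPred.lt {f g : α → ℕ} (hf : Primrec f) (hg : Primrec g) :
    PrimrecPred fun a => f a < g a :=
  Primrec.nat_lt.comp hf hg

theorem Primrec.two_pow {f : α → ℕ} (hf : Primrec f) : Primrec fun a => 2 ^ f a := by
  have h : Primrec fun k : ℕ => 2 ^ k :=
    (Primrec.nat_rec₁ 1 (Primrec.nat_mul.comp₂ Primrec₂.right (Primrec₂.const 2))).of_eq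
      fun k => by
        induction k with
        | zero => rfl
        | succ k ih => rw [pow_succ, ← ih]
  exact h.comp hf

theorem PrimrecPred.testBit {f g : α → ℕ} (hf : Primrec f) (hg : Primrec g) :
    PrimrecPred fun a => (f a).testBit (g a) = true :=
  (PrimrecPred.eq (Primrec.nat_mod.comp (Primrec.nat_div.comp hf hg.two_pow) (Primrec.const 2))
    (Primrec.const 1)).of_eq fun a => by
      rw [Nat.testBit_eq_decide_div_mod_eq, decide_eq_true_iff]

theorem Primrec.add_one {f : α → ℕ} (hf : Primrec f) : Primrec fun a => f a + 1 :=
  Primrec.succ.comp hf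

theorem Primrec.position {f g k : α → ℕ} (hf : Primrec f) (hg : Primrec g) (hk : Primrec k) :
    Primrec fun a => position (f a) (g a) (k a) :=
  Primrec₂.natPair.comp hf (Primrec₂.natPair.comp hg hk)

theorem Primrec.entry {R : α → List (List ℕ)} {f g : α → ℕ} (hR : Primrec R) (hf : Primrec f)
    (hg : Primrec g) : Primrec fun a => entry (R a) (f a) (g a) :=
  (Primrec.list_getD 0).comp ((Primrec.list_getD []).comp hR hf) hg

variable {T : α → OperationTables} {f g k l : α → ℕ}

theorem PrimrecPred.isZero (hT : Primrec T) (hf : Primrec f) :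
    PrimrecPred fun a => IsZero (T a) (f a) := by
  unfold IsZero
  repeat' with_reducible first
    | exact Primrec.fun_id | apply PrimrecPred.ball_lt | apply PrimrecPred.eq | apply Primrec.entry
    | apply hT.comp | apply hf.comp | apply Primrec.list_length.comp
    | apply Primrec.fst.comp | apply Primrec.snd.comp

theorem PrimrecPred.combines (hT : Primrec T) (hf : Primrec f) (hg : Primrec g) (hk : Primrec k) :
    PrimrecPred fun a => Combines (T a) (f a) (g a) (k a) := by
  unfold Combines
  repeat' with_reducible first
    | exact Primrec.fun_id | apply PrimrecPred.ball_lt | apply PrimrecPred.bex_lt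
    | apply PrimrecPred.and | apply PrimrecPred.testBit | apply PrimrecPred.eq
    | apply PrimrecPred.imp | apply Primrec.entry | apply hT.comp | apply hf.comp | apply hg.comp
    | apply hk.comp | apply Primrec.list_length.comp | apply Primrec.fst.comp
    | apply Primrec.snd.comp

theorem PrimrecPred.closed (hT : Primrec T) (hf : Primrec f) (hg : Primrec g) (hk : Primrec k) :
    PrimrecPred fun a => Closed (T a) (f a) (g a) (k a) := by
  unfold Closed
  repeat' with_reducible first
    | exact Primrec.fun_id | apply PrimrecPred.ball_lt
    | apply PrimrecPred.and | apply PrimrecPred.testBit | apply PrimrecPred.isZero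
    | apply PrimrecPred.imp | apply Primrec.entry | apply hT.comp | apply hf.comp | apply hg.comp
    | apply hk.comp | apply Primrec.list_length.comp | apply Primrec.fst.comp
    | apply Primrec.snd.comp

theorem PrimrecPred.spans (hT : Primrec T) (hf : Primrec f) (hg : Primrec g) (hk : Primrec k) :
    PrimrecPred fun a => Spans (T a) (f a) (g a) (k a) := by
  unfold Spans
  repeat' with_reducible first
    | exact Primrec.fun_id | apply PrimrecPred.ball_lt | apply PrimrecPred.bex_lt
    | apply PrimrecPred.and | apply PrimrecPred.testBit | apply PrimrecPred.closed
    | apply PrimrecPred.imp | apply Primrec.entry | apply hT.comp | apply hf.comp | apply hg.comp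
    | apply hk.comp | apply Primrec.list_length.comp | apply Primrec.two_pow
    | apply Primrec.fst.comp | apply Primrec.snd.comp

theorem PrimrecPred.step (hT : Primrec T) (hf : Primrec f) (hg : Primrec g) (hk : Primrec k)
    (hl : Primrec l) : PrimrecPred fun a => Step (T a) (f a) (g a) (k a) (l a) := by
  unfold Step
  repeat' with_reducible first
    | exact Primrec.fun_id | apply PrimrecPred.bex_lt | apply PrimrecPred.and | apply PrimrecPred.spans
    | apply PrimrecPred.combines | apply hT.comp | apply hf.comp | apply hg.comp | apply hk.comp
    | apply hl.comp | apply Primrec.list_length.comp | apply Primrec.two_pow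
    | apply Primrec.fst.comp | apply Primrec.snd.comp

theorem PrimrecPred.invariant (hT : Primrec T) (hf : Primrec f) :
    PrimrecPred fun a => Invariant (T a) (f a) := by
  unfold Invariant
  repeat' with_reducible first
    | exact Primrec.fun_id | exact Primrec.const _ | apply PrimrecPred.ball_lt
    | apply PrimrecPred.and | apply PrimrecPred.testBit | apply PrimrecPred.isZero
    | apply PrimrecPred.step | apply PrimrecPred.imp | apply Primrec.position | apply hT.comp
    | apply hf.comp | apply Primrec.list_length.comp | apply Primrec.two_pow
    | apply Primrec.fst.comp | apply Primrec.snd.comp | apply Primrec.add_one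

theorem PrimrecPred.commonPathset (hT : Primrec T) (hf : Primrec f) (hg : Primrec g) :
    PrimrecPred fun a => CommonPathset (T a) (f a) (g a) := by
  unfold CommonPathset
  repeat' with_reducible first
    | exact Primrec.fun_id | apply PrimrecPred.ball_lt
    | apply PrimrecPred.testBit | apply PrimrecPred.invariant
    | apply PrimrecPred.imp | apply Primrec.position | apply hT.comp
    | apply hf.comp | apply hg.comp | apply Primrec.list_length.comp | apply Primrec.two_pow
    | apply Primrec.fst.comp | apply Primrec.snd.comp | apply Primrec.add_one

end Primrec

/-! ### Recognizing operation tables -/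

namespace OperationTables

/-- `R` is an `a × b` table with entries less than `c`. -/
def HasShape (R : List (List ℕ)) (a b c : ℕ) : Prop :=
  R.length = a ∧ ∀ i < a, (R.getD i []).length = b ∧ ∀ j < b, entry R i j < c

/-- The first table is that of a commutative idempotent monoid, up to the existence of a neutral
element. -/
def IsSemilattice (T : OperationTables) : Prop :=
  (∀ i < T.1.length, ∀ j < T.1.length, ∀ k < T.1.length,
      entry T.1 (entry T.1 i j) k = entry T.1 i (entry T.1 j k)) ∧
    (∀ i < T.1.length, ∀ j < T.1.length, entry T.1 i j = entry T.1 j i) ∧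
    ∀ i < T.1.length, entry T.1 i i = i

/-- `e` is the number of a neutral element of the second table that acts as the identity. -/
def IsOne (T : OperationTables) (e : ℕ) : Prop :=
  (∀ v < T.2.1.length, entry T.2.1 e v = v ∧ entry T.2.1 v e = v) ∧
    ∀ i < T.1.length, entry T.2.2 e i = i

/-- The second and the third table satisfy the associative laws. -/
def IsAssoc (T : OperationTables) : Prop :=
  ∀ v < T.2.1.length, ∀ w < T.2.1.length,
    (∀ x < T.2.1.length,
      entry T.2.1 (entry T.2.1 v w) x = entry T.2.1 v (entry T.2.1 w x)) ∧
    ∀ i < T.1.length, entry T.2.2 (entry T.2.1 v w) i = entry T.2.2 v (entry T.2.2 w i)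

/-- The laws of a forest algebra beyond those of a monoid action. -/
def IsForestAction (T : OperationTables) : Prop :=
  (∀ v < T.2.1.length, ∀ w < T.2.1.length,
      (∀ i < T.1.length, entry T.2.2 v i = entry T.2.2 w i) → v = w) ∧
    (∀ i < T.1.length, ∃ v < T.2.1.length, ∀ j < T.1.length, entry T.2.2 v j = entry T.1 i j) ∧
    ∃ k < T.1.length, IsZero T k ∧ ∀ i < T.1.length, ∃ v < T.2.1.length, entry T.2.2 v k = i

/-- `T` consists of the operation tables of a finite forest algebra. -/
def IsValid (T : OperationTables) : Prop :=
  HasShape T.1 T.1.length T.1.length T.1.length ∧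
    HasShape T.2.1 T.2.1.length T.2.1.length T.2.1.length ∧
    HasShape T.2.2 T.2.1.length T.1.length T.1.length ∧
    IsSemilattice T ∧ (∃ e < T.2.1.length, IsOne T e) ∧ IsAssoc T ∧ IsForestAction T

/-- Contexts distribute over the forest types that have a common pathset. -/
def Distributes (T : OperationTables) : Prop :=
  ∀ h < T.1.length, ∀ h' < T.1.length, CommonPathset T h h' → ∀ v < T.2.1.length,
    entry T.2.2 v (entry T.1 h h') = entry T.1 (entry T.2.2 v h) (entry T.2.2 v h')

theorem HasShape.eq_ofFn {R : List (List ℕ)} {a b c : ℕ} (h : HasShape R a b c) :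
    R = List.ofFn fun i : Fin a => List.ofFn fun j : Fin b => entry R i j := by
  obtain ⟨rfl, h⟩ := h
  refine List.ext_getElem (by simp) fun i hi _ => ?_
  have hRi : R.getD i [] = R[i] := List.getD_eq_getElem _ _ hi
  have hb := (h i hi).1
  rw [hRi] at hb
  rw [List.getElem_ofFn]
  refine List.ext_getElem (by simp [hb]) fun j hj _ => ?_
  rw [List.getElem_ofFn]
  simp only [entry]
  rw [hRi, List.getD_eq_getElem _ _ hj]

theorem hasShape_ofFn {a b c : ℕ} (k : Fin a → Fin b → Fin c) :
    HasShape (List.ofFn fun i => List.ofFn fun j => (k i j : ℕ)) a b c := by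
  refine ⟨List.length_ofFn, fun i hi => ⟨?_, fun j hj => ?_⟩⟩
  · simp [List.getD_eq_getElem?_getD, hi]
  · have := entry_ofFn (fun i j => (k i j : ℕ)) ⟨i, hi⟩ ⟨j, hj⟩
    simp only at this
    rw [this]
    exact (k _ _).2

section Primrec

variable {α : Type u} [Primcodable α] {T : α → OperationTables}

theorem primrecPred_hasShape {R : α → List (List ℕ)} {f g k : α → ℕ} (hR : Primrec R)
    (hf : Primrec f) (hg : Primrec g) (hk : Primrec k) :
    PrimrecPred fun a => HasShape (R a) (f a) (g a) (k a) := by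
  have hrow {β : Type u} [Primcodable β] {R : β → List (List ℕ)} {f : β → ℕ} (hR : Primrec R)
      (hf : Primrec f) : Primrec fun a => ((R a).getD (f a) []).length :=
    Primrec.list_length.comp ((Primrec.list_getD []).comp hR hf)
  unfold HasShape
  repeat' with_reducible first
    | exact Primrec.fun_id | apply PrimrecPred.ball_lt | apply PrimrecPred.and | apply hrow
    | apply PrimrecPred.eq | apply PrimrecPred.lt | apply Primrec.entry | apply hR.comp
    | apply hf.comp | apply hg.comp | apply hk.comp | apply Primrec.list_length.comp
    | apply Primrec.fst.comp | apply Primrec.snd.comp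

theorem primrecPred_isSemilattice (hT : Primrec T) :
    PrimrecPred fun a => IsSemilattice (T a) := by
  unfold IsSemilattice
  repeat' with_reducible first
    | exact Primrec.fun_id | apply PrimrecPred.ball_lt | apply PrimrecPred.and
    | apply PrimrecPred.eq | apply Primrec.entry | apply hT.comp | apply Primrec.list_length.comp
    | apply Primrec.fst.comp | apply Primrec.snd.comp

theorem primrecPred_isOne {f : α → ℕ} (hT : Primrec T) (hf : Primrec f) :
    PrimrecPred fun a => IsOne (T a) (f a) := by
  unfold IsOne
  repeat' with_reducible first
    | exact Primrec.fun_id | apply PrimrecPred.ball_lt | apply PrimrecPred.and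
    | apply PrimrecPred.eq | apply Primrec.entry | apply hT.comp | apply hf.comp
    | apply Primrec.list_length.comp | apply Primrec.fst.comp | apply Primrec.snd.comp

theorem primrecPred_isAssoc (hT : Primrec T) : PrimrecPred fun a => IsAssoc (T a) := by
  unfold IsAssoc
  repeat' with_reducible first
    | exact Primrec.fun_id | apply PrimrecPred.ball_lt | apply PrimrecPred.and
    | apply PrimrecPred.eq | apply Primrec.entry | apply hT.comp | apply Primrec.list_length.comp
    | apply Primrec.fst.comp | apply Primrec.snd.comp

theorem primrecPred_isForestAction (hT : Primrec T) :
    PrimrecPred fun a => IsForestAction (T a) := by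
  unfold IsForestAction
  repeat' with_reducible first
    | exact Primrec.fun_id | apply PrimrecPred.ball_lt | apply PrimrecPred.bex_lt
    | apply PrimrecPred.and | apply PrimrecPred.eq | apply PrimrecPred.isZero
    | apply PrimrecPred.imp | apply Primrec.entry | apply hT.comp | apply Primrec.list_length.comp
    | apply Primrec.fst.comp | apply Primrec.snd.comp

theorem primrecPred_isValid (hT : Primrec T) : PrimrecPred fun a => IsValid (T a) := by
  unfold IsValid
  repeat' with_reducible first
    | exact Primrec.fun_id | apply PrimrecPred.bex_lt | apply PrimrecPred.and
    | apply primrecPred_hasShape | apply primrecPred_isSemilattice | apply primrecPred_isOne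
    | apply primrecPred_isAssoc | apply primrecPred_isForestAction | apply hT.comp
    | apply Primrec.list_length.comp | apply Primrec.fst.comp | apply Primrec.snd.comp

theorem primrecPred_distributes (hT : Primrec T) : PrimrecPred fun a => Distributes (T a) := by
  unfold Distributes
  repeat' with_reducible first
    | exact Primrec.fun_id | apply PrimrecPred.ball_lt | apply PrimrecPred.commonPathset
    | apply PrimrecPred.eq | apply PrimrecPred.imp | apply Primrec.entry | apply hT.comp
    | apply Primrec.list_length.comp | apply Primrec.fst.comp | apply Primrec.snd.comp

end Primrec

theorem isValid_operationTables {H : Type u} {V : Type v} [AddCommMonoid H] [Monoid V]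
    [ForestAlgebra H V] {n m : ℕ} (eH : H ≃ Fin n) (eV : V ≃ Fin m) :
    IsValid (operationTables eH eV) := by
  rw [IsValid, length_operationTables, length_operationTables_mul]
  refine ⟨hasShape_ofFn _, hasShape_ofFn _, hasShape_ofFn _, ?_, ⟨eV 1, (eV 1).2, ?_⟩, ?_, ?_⟩
  · simp only [IsSemilattice, length_operationTables, forall_lt_iff_forall eH, entry_add]
    exact ⟨fun i j k => by rw [add_assoc], fun i j => by rw [add_comm],
      fun i => by rw [ForestAlgebra.add_idem V]⟩
  · simp only [IsOne, length_operationTables, length_operationTables_mul, forall_lt_iff_forall eH,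
      forall_lt_iff_forall eV, entry_mul, entry_smul, one_mul, mul_one, one_smul, and_self,
      implies_true]
  · simp only [IsAssoc, length_operationTables, length_operationTables_mul,
      forall_lt_iff_forall eH, forall_lt_iff_forall eV, entry_mul, entry_smul, mul_assoc, mul_smul,
      and_self, implies_true]
  · simp only [IsForestAction, length_operationTables, length_operationTables_mul,
      forall_lt_iff_forall eH, forall_lt_iff_forall eV, exists_lt_iff_exists eH,
      exists_lt_iff_exists eV, entry_add, entry_smul, isZero_iff, exists_eq_left, Fin.val_inj,
      eH.injective.eq_iff, eV.injective.eq_iff]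
    exact ⟨ForestAlgebra.faithful, fun i => ⟨_, ForestAlgebra.ins_smul i⟩,
      ForestAlgebra.exists_smul_zero⟩

/-- A table of the right shape is that of an operation on the numbered elements. -/
theorem HasShape.exists_eq {R : List (List ℕ)} {a b c : ℕ} (h : HasShape R a b c) {X : Type u}
    {Y : Type v} {Z : Type w} (eX : X ≃ Fin a) (eY : Y ≃ Fin b) (eZ : Z ≃ Fin c) :
    ∃ op : X → Y → Z, ∀ x y, entry R (eX x) (eY y) = eZ (op x y) :=
  ⟨fun x y => eZ.symm ⟨_, (h.2 _ (eX x).2).2 _ (eY y).2⟩, fun x y => by simp⟩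

/-- Valid tables are operation tables. -/
theorem IsValid.exists_forestAlgebra {T : OperationTables} (hT : IsValid T) {H V : Type}
    (eH : H ≃ Fin T.1.length) (eV : V ≃ Fin T.2.1.length) :
    ∃ (_ : AddCommMonoid H) (_ : Monoid V) (_ : ForestAlgebra H V),
      T = operationTables eH eV := by
  obtain ⟨hs₁, hs₂, hs₃, hlat, hone, hassoc, hact⟩ := hT
  obtain ⟨plus, hplus⟩ := hs₁.exists_eq eH eH eH
  obtain ⟨times, htimes⟩ := hs₂.exists_eq eV eV eV
  obtain ⟨act, hacts⟩ := hs₃.exists_eq eV eH eH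
  simp only [IsSemilattice, forall_lt_iff_forall eH, hplus, Fin.val_inj,
    eH.injective.eq_iff] at hlat
  simp only [IsOne, forall_lt_iff_forall eH, forall_lt_iff_forall eV, exists_lt_iff_exists eV,
    htimes, hacts, Fin.val_inj, eH.injective.eq_iff, eV.injective.eq_iff] at hone
  simp only [IsAssoc, forall_lt_iff_forall eH, forall_lt_iff_forall eV, htimes, hacts,
    Fin.val_inj, eH.injective.eq_iff, eV.injective.eq_iff] at hassoc
  simp only [IsForestAction, IsZero, forall_lt_iff_forall eH, forall_lt_iff_forall eV,
    exists_lt_iff_exists eH, exists_lt_iff_exists eV, hplus, hacts, Fin.val_inj,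
    eH.injective.eq_iff, eV.injective.eq_iff] at hact
  obtain ⟨hplus_assoc, hplus_comm, hidem⟩ := hlat
  obtain ⟨e, he, heact⟩ := hone
  obtain ⟨hfaith, hins, o, ho, hgen⟩ := hact
  choose ins hins using hins
  let instH : AddCommMonoid H :=
    { add := plus
      zero := o
      add_assoc := hplus_assoc
      zero_add := ho
      add_zero := fun x => (hplus_comm x o).trans (ho x)
      add_comm := hplus_comm
      nsmul := @nsmulRec _ ⟨o⟩ ⟨plus⟩ }
  let instV : Monoid V :=
    { mul := times
      one := e
      mul_assoc := fun x y z => (hassoc x y).1 z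
      one_mul := fun x => (he x).1
      mul_one := fun x => (he x).2 }
  let instA : ForestAlgebra H V :=
    { smul := act
      one_smul := heact
      mul_smul := fun x y h => (hassoc x y).2 h
      add_idem := hidem
      faithful := hfaith
      ins := ins
      ins_smul := hins
      exists_smul_zero := hgen }
  refine ⟨instH, instV, instA, ?_⟩
  refine Prod.ext (hs₁.eq_ofFn.trans ?_) (Prod.ext (hs₂.eq_ofFn.trans ?_) (hs₃.eq_ofFn.trans ?_))
  · refine congrArg List.ofFn (funext fun i => congrArg List.ofFn (funext fun j => ?_))
    have := hplus (eH.symm i) (eH.symm j)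
    rw [Equiv.apply_symm_apply, Equiv.apply_symm_apply] at this
    exact this
  · refine congrArg List.ofFn (funext fun i => congrArg List.ofFn (funext fun j => ?_))
    have := htimes (eV.symm i) (eV.symm j)
    rw [Equiv.apply_symm_apply, Equiv.apply_symm_apply] at this
    exact this
  · refine congrArg List.ofFn (funext fun i => congrArg List.ofFn (funext fun j => ?_))
    have := hacts (eV.symm i) (eH.symm j)
    rw [Equiv.apply_symm_apply, Equiv.apply_symm_apply] at this
    exact this

theorem distributes_iff {H : Type u} {V : Type v} [AddCommMonoid H] [Monoid V]
    [ForestAlgebra H V] {n m : ℕ} (eH : H ≃ Fin n) (eV : V ≃ Fin m) :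
    Distributes (operationTables eH eV) ↔ IsTwoDistributive H V := by
  have : Finite V := Finite.of_equiv _ eV.symm
  rw [isTwoDistributive_iff]
  simp only [Distributes, length_operationTables, length_operationTables_mul,
    forall_lt_iff_forall eH, forall_lt_iff_forall eV, entry_add, entry_smul, commonPathset_iff,
    Fin.val_inj, eH.injective.eq_iff]

end OperationTables

/-- A primitive recursive predicate has a computable characteristic function. -/
theorem PrimrecPred.exists_computable {α : Type u} [Primcodable α] {p : α → Prop}
    (hp : PrimrecPred p) : ∃ d : α → Bool, Computable d ∧ ∀ a, d a = true ↔ p a := by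
  obtain ⟨_, hp⟩ := hp
  exact ⟨_, hp.to_comp, fun _ => decide_eq_true_iff⟩

/-! ### Decidability of 2-distributivity -/

theorem mainTheorem2 :
    -- It is decidable whether a finite forest algebra is 2-distributive.
    (∃ isTwoDistributive : OperationTables → Bool, Computable isTwoDistributive ∧
      (∀ (H : Type u) (V : Type v) [AddCommMonoid H] [Monoid V] [ForestAlgebra H V]
        (n m : ℕ) (eH : H ≃ Fin n) (eV : V ≃ Fin m),
        isTwoDistributive (operationTables eH eV) = true ↔ IsTwoDistributive H V) ∧
      (∀ T : OperationTables, isTwoDistributive T = true →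
        ∃ (H V : Type) (_ : AddCommMonoid H) (_ : Monoid V) (_ : ForestAlgebra H V)
          (n m : ℕ) (eH : H ≃ Fin n) (eV : V ≃ Fin m), T = operationTables eH eV)) ∧
    -- The test reduces to finding the pairs of forest types with a common pathset,
    (∀ (H : Type u) (V : Type v) [AddCommMonoid H] [Monoid V] [ForestAlgebra H V]
      [Finite H] [Finite V],
      IsTwoDistributive H V ↔ ∀ h h' : H, HaveCommonPathset (typeLanguage V h) (typeLanguage V h') →
        ∀ v : V, v • (h + h') = v • h + v • h') ∧
    -- and this is decidable.
    (∃ haveCommonPathset : OperationTables × ℕ × ℕ → Bool, Computable haveCommonPathset ∧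
      ∀ (H : Type u) (V : Type v) [AddCommMonoid H] [Monoid V] [ForestAlgebra H V]
        (n m : ℕ) (eH : H ≃ Fin n) (eV : V ≃ Fin m) (h h' : H),
        haveCommonPathset (operationTables eH eV, eH h, eH h') = true ↔
          HaveCommonPathset (typeLanguage V h) (typeLanguage V h')) ∧
    -- Languages have a common pathset if and only if their normal forms intersect,
    (∀ (A : Type u) [Finite A] (L₁ L₂ : Set (Forest A)),
      HaveCommonPathset L₁ L₂ ↔
        (Forest.normalForm '' L₁ ∩ Forest.normalForm '' L₂).Nonempty) ∧
    -- and the normal forms of a regular language form a regular language.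
    (∀ (A : Type u) [Finite A] (L : Set (Forest A)),
      IsRegularForestLanguage L → ForestTerm.IsRegular (normalFormTerms L)) := by
  refine ⟨?_, fun H V _ _ _ _ _ => isTwoDistributive_iff, ?_,
    fun A _ L₁ L₂ => Forest.haveCommonPathset_iff_normalForm L₁ L₂,
    fun A _ L hL => ForestTerm.isRegular_normalFormTerms hL⟩
  · obtain ⟨d, hd, hdT⟩ := ((OperationTables.primrecPred_isValid Primrec.id).and
      (OperationTables.primrecPred_distributes Primrec.id)).exists_computable
    refine ⟨d, hd, fun H V _ _ _ n m eH eV => ?_, fun T hT => ?_⟩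
    · rw [hdT]
      exact (and_iff_right (OperationTables.isValid_operationTables eH eV)).trans
        (OperationTables.distributes_iff eH eV)
    · obtain ⟨hv, _⟩ := (hdT T).1 hT
      obtain ⟨iH, iV, iA, h⟩ := hv.exists_forestAlgebra (Equiv.refl _) (Equiv.refl _)
      exact ⟨_, _, iH, iV, iA, _, _, _, _, h⟩
  · obtain ⟨d, hd, hdT⟩ := (PrimrecPred.commonPathset
      (T := fun a : OperationTables × ℕ × ℕ => a.1) Primrec.fst (Primrec.fst.comp Primrec.snd)
      (Primrec.snd.comp Primrec.snd)).exists_computable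
    exact ⟨d, hd, fun H V _ _ _ n m eH eV h h' =>
      (hdT _).trans (commonPathset_iff eH eV h h')⟩
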